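/- Let $d\ge 2$, let $\Omega\subset\mathbb{R}^d$ be a bounded Lipschitz domain (open, connected, locally the region above the graph of a Lipschitz function in suitable Cartesian coordinates), and let $\Gamma\subseteq\partial\Omega$ be nonempty and relatively open, equipped with surface measure. Let $L^\infty(\Omega;\mathbb{C}^{d\times d})$ carry the norm $\|B\|=\operatorname{ess\,sup}_{x\in\Omega}\|B(x)\|_2$ with the spectral norm $\|\cdot\|_2$, and let $L^\infty_+(\Omega)$ be the set of those $A\in L^\infty(\Omega;\mathbb{C}^{d\times d})$ for which there is $c_A>0$ such that $\operatorname{ess\,inf}_{x\in\Omega}\operatorname{Re}[(A(x)\xi)\cdot\overline{\xi}]\ge c_A|\xi|^2$ for all $\xi\in\mathbb{C}^d$; any such $c_A$ is called an ellipticity constant of $A$. Let $T:H^1(\Omega)\to L^2(\Gamma)$ be the Dirichlet trace operator onto $\Gamma$, i.e. the bounded linear operator that maps functions smooth up to the boundary to their restrictions to $\Gamma$, and put $$L^2_\diamond(\Gamma)=\Bigl\{g\in L^2(\Gamma): \int_\Gamma g\,dS=0\Bigr\},\qquad H^1_\diamond(\Omega)=\{w\in H^1(\Omega): Tw\in L^2_\diamond(\Gamma)\},\qquad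 \langle w,v\rangle_B=\int_\Omega (B\nabla w)\cdot\overline{\nabla v}\,dx .$$ There is a constant $C$ with $\|w\|_{H^1(\Omega)}^2\le C\int_\Omega|\nabla w|^2\,dx$ for all $w\in H^1_\diamond(\Omega)$, so that on $H^1_\diamond(\Omega)$ the $H^1(\Omega)$-norm and the norm $\|\nabla w\|_{L^2(\Omega)}$ are equivalent. For $A\in L^\infty_+(\Omega)$ there are well-defined bounded linear maps $N(A):L^2_\diamond(\Gamma)\to H^1_\diamond(\Omega)$, $\Lambda(A)=TN(A):L^2_\diamond(\Gamma)\to L^2_\diamond(\Gamma)$ (the local Neumann-to-Dirichlet map) and $P_A: L^\infty(\Omega;\mathbb{C}^{d\times d})\to\mathscr{L}(H^1_\diamond(\Omega))$, where $N(A)f$ and $P_A(B)y$ are the unique elements of $H^1_\diamond(\Omega)$ such that $$\langle N(A)f,v\rangle_A=\langle f,Tv\rangle_{L^2(\Gamma)}\quad\text{and}\quad \langle P_A(B)y,v\rangle_A=-\langle y,v\rangle_B\qquad\text{for all } v\in H^1(\Omega).$$ The set $L^\infty_+(\Omega)$ is open, and the maps $N:L^\infty_+(\Omega)\to\mathscr{L}(L^2_\diamond(\Gamma),H^1_\diamond(\Omega))$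 and $\Lambda:L^\infty_+(\Omega)\to\mathscr{L}(L^2_\diamond(\Gamma))$ are infinitely many times continuously (complex) Fréchet differentiable. For all $A\in L^\infty_+(\Omega)$, $k\in\mathbb{N}\cup\{0\}$ and $B_1,\dots,B_k\in L^\infty(\Omega;\mathbb{C}^{d\times d})$, $$D^kN(A;B_1,\dots,B_k)=\Bigl[\sum_{\alpha}P_A(B_{\alpha_1})\cdots P_A(B_{\alpha_k})\Bigr]N(A),\qquad D^k\Lambda(A;B_1,\dots,B_k)=T\,D^kN(A;B_1,\dots,B_k),$$ where the sum is over all permutations $\alpha=(\alpha_1,\dots,\alpha_k)$ of $(1,\dots,k)$. Both maps are analytic on $L^\infty_+(\Omega)$, and whenever $A\in L^\infty_+(\Omega)$ has ellipticity constant $c_A>0$ and $\|B\|<c_A$, then $A+B\in L^\infty_+(\Omega)$ and $$N(A+B)=\sum_{k=0}^\infty\frac1{k!}D^kN(A;B,\dots,B)=\sum_{k=0}^\infty P_A(B)^kN(A),$$ $$\Lambda(A+B)=\sum_{k=0}^\infty\frac1{k!}D^k\Lambda(A;B,\dots,B)=T\sum_{k=0}^\infty P_A(B)^kN(A),$$ with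 convergence of the series in the respective operator norms. -/

import Mathlib

open MeasureTheory
open scoped ENNReal NNReal ContDiff Matrix.Norms.L2Operator

noncomputable section

/-- A bounded Lipschitz domain of `ℝ^d`: a bounded, nonempty, connected open set which, near each
of its boundary points and in suitable Cartesian coordinates (with vertical direction `e`),
is the region strictly above the graph of a Lipschitz function. -/
structure IsBoundedLipschitzDomain {d : ℕ} (Ω : Set (EuclideanSpace ℝ (Fin d))) : Prop where
  isOpen : IsOpen Ω
  isConnected : IsConnected Ω
  isBounded : Bornology.IsBounded Ω
  exists_graph : ∀ p ∈ frontier Ω,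
    ∃ (e : EuclideanSpace ℝ (Fin d)) (γ : ↥(Submodule.span ℝ {e})ᗮ → ℝ) (K : ℝ≥0) (r : ℝ),
      ‖e‖ = 1 ∧ LipschitzWith K γ ∧ 0 < r ∧
      ∀ x ∈ Metric.ball p r,
        (x ∈ Ω ↔ γ ((Submodule.span ℝ {e})ᗮ.orthogonalProjectionOnto x) < inner ℝ e x)

/-- `Γ` is a relatively open subset of the boundary of `Ω`. -/
def IsRelOpenBoundary {d : ℕ} (Ω Γ : Set (EuclideanSpace ℝ (Fin d))) : Prop :=
  ∃ U : Set (EuclideanSpace ℝ (Fin d)), IsOpen U ∧ Γ = U ∩ frontier Ω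

/-! ### Coefficients -/

/-- `L^∞(Ω; ℂ^{d×d})`, normed by the essential supremum of the spectral norm. -/
abbrev Coeff {d : ℕ} (Ω : Set (EuclideanSpace ℝ (Fin d))) : Type :=
  Lp (Matrix (Fin d) (Fin d) ℂ) ∞ ((volume : Measure (EuclideanSpace ℝ (Fin d))).restrict Ω)

/-- The action of a complex matrix on `ℂ^d` with its Euclidean structure. -/
def matAct {d : ℕ} (M : Matrix (Fin d) (Fin d) ℂ) (ξ : EuclideanSpace ℂ (Fin d)) :
    EuclideanSpace ℂ (Fin d) :=
  WithLp.toLp 2 (M.mulVec ξ)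

/-- `c` is an ellipticity constant of `A`: for every `ξ`, the essential infimum over `Ω` of
`Re (A(x) ξ) · conj ξ` is at least `c |ξ|^2`. Mathlib's inner product is conjugate linear in its
first argument. -/
def IsEllipticityConst {d : ℕ} {Ω : Set (EuclideanSpace ℝ (Fin d))} (A : Coeff Ω) (c : ℝ) : Prop :=
  ∀ ξ : EuclideanSpace ℂ (Fin d), ∀ᵐ x ∂(volume.restrict Ω),
    c * ‖ξ‖ ^ 2 ≤ (inner ℂ ξ (matAct (A x) ξ)).re

/-- The set `L^∞_+(Ω)` of elliptic coefficients. -/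
def ellipticCoeff {d : ℕ} (Ω : Set (EuclideanSpace ℝ (Fin d))) : Set (Coeff Ω) :=
  {A | ∃ c : ℝ, 0 < c ∧ IsEllipticityConst A c}

/-! ### The Sobolev space `H^1(Ω)` -/

/-- `L^2(Ω)`. -/
abbrev L2Dom {d : ℕ} (Ω : Set (EuclideanSpace ℝ (Fin d))) : Type :=
  Lp ℂ 2 ((volume : Measure (EuclideanSpace ℝ (Fin d))).restrict Ω)

/-- `L^2(Ω; ℂ^d)`. -/
abbrev L2VecDom {d : ℕ} (Ω : Set (EuclideanSpace ℝ (Fin d))) : Type :=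
  Lp (EuclideanSpace ℂ (Fin d)) 2 ((volume : Measure (EuclideanSpace ℝ (Fin d))).restrict Ω)

/-- `g` is the weak gradient of `u` in `Ω`. -/
def IsWeakGradient {d : ℕ} {Ω : Set (EuclideanSpace ℝ (Fin d))} (u : L2Dom Ω) (g : L2VecDom Ω) :
    Prop :=
  ∀ φ : EuclideanSpace ℝ (Fin d) → ℝ, ContDiff ℝ ∞ φ → HasCompactSupport φ → tsupport φ ⊆ Ω →
    ∀ i : Fin d,
      ∫ x in Ω, (fderiv ℝ φ x (EuclideanSpace.single i 1)) • u x = - ∫ x in Ω, φ x • g x i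

theorem integrable_smul_L2Dom {d : ℕ} {Ω : Set (EuclideanSpace ℝ (Fin d))}
    {ψ : EuclideanSpace ℝ (Fin d) → ℝ} (hψ : Continuous ψ) (hc : HasCompactSupport ψ)
    {u : EuclideanSpace ℝ (Fin d) → ℂ} (hu : MemLp u 2 (volume.restrict Ω)) :
    Integrable (fun x => ψ x • u x) (volume.restrict Ω) :=
  memLp_one_iff_integrable.1
    (MemLp.smul hu ((hψ.memLp_of_hasCompactSupport (p := 2) (μ := volume) hc).restrict Ω))

theorem memLp_coord {d : ℕ} {Ω : Set (EuclideanSpace ℝ (Fin d))} (g : L2VecDom Ω) (i : Fin d) :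
    MemLp (fun x => g x i) 2 (volume.restrict Ω) :=
  (EuclideanSpace.proj i : EuclideanSpace ℂ (Fin d) →L[ℂ] ℂ).comp_memLp' (Lp.memLp g)

/-- The pairs `(u, ∇u)` of a function in `L^2(Ω)` and its weak gradient in `L^2(Ω; ℂ^d)`; the ambient
norm is `(‖u‖^2 + ‖∇u‖^2)^{1/2}`. -/
def weakGradientGraph {d : ℕ} (Ω : Set (EuclideanSpace ℝ (Fin d))) :
    Submodule ℂ (WithLp 2 (L2Dom Ω × L2VecDom Ω)) where
  carrier := {w | IsWeakGradient w.fst w.snd}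
  zero_mem' := by
    intro φ _ _ _ i
    have h1 : ∫ x in Ω, (fderiv ℝ φ x (EuclideanSpace.single i 1)) • (0 : L2Dom Ω) x = 0 := by
      refine integral_eq_zero_of_ae ?_
      filter_upwards [Lp.coeFn_zero ℂ 2 (volume.restrict Ω)] with x hx
      rw [hx]; simp
    have h2 : ∫ x in Ω, φ x • (0 : L2VecDom Ω) x i = 0 := by
      refine integral_eq_zero_of_ae ?_
      filter_upwards [Lp.coeFn_zero (EuclideanSpace ℂ (Fin d)) 2 (volume.restrict Ω)] with x hx
      rw [hx]; simp
    change ∫ x in Ω, (fderiv ℝ φ x (EuclideanSpace.single i 1)) • (0 : L2Dom Ω) x =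
      - ∫ x in Ω, φ x • (0 : L2VecDom Ω) x i
    rw [h1, h2, neg_zero]
  add_mem' := by
    intro v w hv hw φ hφ hc hs i
    have hd : Continuous fun x => fderiv ℝ φ x (EuclideanSpace.single i 1) :=
      (hφ.continuous_fderiv (by simp)).clm_apply continuous_const
    have hdc : HasCompactSupport fun x => fderiv ℝ φ x (EuclideanSpace.single i 1) :=
      hc.fderiv_apply (𝕜 := ℝ) _
    change ∫ x in Ω, (fderiv ℝ φ x (EuclideanSpace.single i 1)) • (v.fst + w.fst : L2Dom Ω) x =
      - ∫ x in Ω, φ x • (v.snd + w.snd : L2VecDom Ω) x i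
    have h1 : ∫ x in Ω, (fderiv ℝ φ x (EuclideanSpace.single i 1)) • (v.fst + w.fst : L2Dom Ω) x =
        ∫ x in Ω, ((fderiv ℝ φ x (EuclideanSpace.single i 1)) • v.fst x +
          (fderiv ℝ φ x (EuclideanSpace.single i 1)) • w.fst x) := by
      refine integral_congr_ae ?_
      filter_upwards [Lp.coeFn_add v.fst w.fst] with x hx
      rw [hx]; simp [smul_add]
    have h2 : ∫ x in Ω, φ x • (v.snd + w.snd : L2VecDom Ω) x i =
        ∫ x in Ω, (φ x • v.snd x i + φ x • w.snd x i) := by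
      refine integral_congr_ae ?_
      filter_upwards [Lp.coeFn_add v.snd w.snd] with x hx
      rw [hx]; simp [smul_add]
    rw [h1, h2, integral_add (integrable_smul_L2Dom hd hdc (Lp.memLp _))
        (integrable_smul_L2Dom hd hdc (Lp.memLp _)),
      integral_add (integrable_smul_L2Dom hφ.continuous hc (memLp_coord _ i))
        (integrable_smul_L2Dom hφ.continuous hc (memLp_coord _ i)),
      hv φ hφ hc hs i, hw φ hφ hc hs i, neg_add]
  smul_mem' := by
    intro c w hw φ hφ hc hs i
    change ∫ x in Ω, (fderiv ℝ φ x (EuclideanSpace.single i 1)) • (c • w.fst : L2Dom Ω) x =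
      - ∫ x in Ω, φ x • (c • w.snd : L2VecDom Ω) x i
    have h1 : ∫ x in Ω, (fderiv ℝ φ x (EuclideanSpace.single i 1)) • (c • w.fst : L2Dom Ω) x =
        ∫ x in Ω, c • ((fderiv ℝ φ x (EuclideanSpace.single i 1)) • w.fst x) := by
      refine integral_congr_ae ?_
      filter_upwards [Lp.coeFn_smul c w.fst] with x hx
      rw [hx]; simp [mul_left_comm]
    have h2 : ∫ x in Ω, φ x • (c • w.snd : L2VecDom Ω) x i =
        ∫ x in Ω, c • (φ x • w.snd x i) := by
      refine integral_congr_ae ?_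
      filter_upwards [Lp.coeFn_smul c w.snd] with x hx
      rw [hx]; simp [mul_left_comm]
    rw [h1, h2, integral_smul, integral_smul, hw φ hφ hc hs i, smul_neg]

/-- `H^1(Ω)`, the functions in `L^2(Ω)` with weak gradient in `L^2(Ω; ℂ^d)`. An element is recorded
as the pair of the function and its (unique) weak gradient. -/
def H1 {d : ℕ} (Ω : Set (EuclideanSpace ℝ (Fin d))) : Type := ↥(weakGradientGraph Ω)

instance {d : ℕ} (Ω : Set (EuclideanSpace ℝ (Fin d))) : NormedAddCommGroup (H1 Ω) :=
  inferInstanceAs (NormedAddCommGroup ↥(weakGradientGraph Ω))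

instance {d : ℕ} (Ω : Set (EuclideanSpace ℝ (Fin d))) : InnerProductSpace ℂ (H1 Ω) :=
  inferInstanceAs (InnerProductSpace ℂ ↥(weakGradientGraph Ω))

/-- The underlying function of an element of `H^1(Ω)`. -/
def H1.toFun {d : ℕ} {Ω : Set (EuclideanSpace ℝ (Fin d))} (w : H1 Ω) : L2Dom Ω :=
  w.val.fst

/-- The weak gradient of an element of `H^1(Ω)`. -/
def H1.grad {d : ℕ} {Ω : Set (EuclideanSpace ℝ (Fin d))} (w : H1 Ω) : L2VecDom Ω :=
  w.val.snd

/-- The sesquilinear form `⟨w, v⟩_B = ∫_Ω (B ∇w) · conj (∇v) dx`. -/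
def coeffForm {d : ℕ} {Ω : Set (EuclideanSpace ℝ (Fin d))} (B : Coeff Ω) (w v : H1 Ω) : ℂ :=
  ∫ x in Ω, inner ℂ (H1.grad v x) (matAct (B x) (H1.grad w x))

/-! ### The boundary piece and the trace -/

/-- The surface measure on `Γ`: the `(d-1)`-dimensional Hausdorff measure, normalised to agree with
Lebesgue measure on hyperplanes. -/
def surfaceMeasure {d : ℕ} (Γ : Set (EuclideanSpace ℝ (Fin d))) :
    Measure (EuclideanSpace ℝ (Fin d)) :=
  (Measure.euclideanHausdorffMeasure (d - 1)).restrict Γ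

/-- `L^2(Γ)`. -/
abbrev L2Bd {d : ℕ} (Γ : Set (EuclideanSpace ℝ (Fin d))) : Type :=
  Lp ℂ 2 (surfaceMeasure Γ)

/-- `T` is the Dirichlet trace operator onto `Γ`: the bounded linear operator from `H^1(Ω)` to
`L^2(Γ)` that maps (the restriction to `Ω` of) a function smooth up to the boundary to its pointwise
restriction to `Γ`. -/
def IsTraceOp {d : ℕ} (Ω Γ : Set (EuclideanSpace ℝ (Fin d))) (T : H1 Ω →L[ℂ] L2Bd Γ) : Prop :=
  ∀ (w : H1 Ω) (φ : EuclideanSpace ℝ (Fin d) → ℂ), ContDiff ℝ ∞ φ →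
    H1.toFun w =ᵐ[volume.restrict Ω] φ → T w =ᵐ[surfaceMeasure Γ] φ

/-- The Dirichlet trace operator `T : H^1(Ω) → L^2(Γ)`. -/
def traceOp {d : ℕ} (Ω Γ : Set (EuclideanSpace ℝ (Fin d))) : H1 Ω →L[ℂ] L2Bd Γ :=
  Classical.epsilon (IsTraceOp Ω Γ)

/-- `L^2_⋄(Γ)`, the elements of `L^2(Γ)` with mean zero. (Integrability is automatic when `Γ` has
finite surface measure.) -/
def L2Mean {d : ℕ} (Γ : Set (EuclideanSpace ℝ (Fin d))) : Submodule ℂ (L2Bd Γ) where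
  carrier := {g | Integrable g (surfaceMeasure Γ) ∧ ∫ x, g x ∂(surfaceMeasure Γ) = 0}
  zero_mem' := by
    have h := Lp.coeFn_zero ℂ 2 (surfaceMeasure Γ)
    exact ⟨(integrable_zero _ _ _).congr h.symm, integral_eq_zero_of_ae h⟩
  add_mem' := by
    rintro f g ⟨hf, hf0⟩ ⟨hg, hg0⟩
    have h := Lp.coeFn_add f g
    refine ⟨(hf.add hg).congr h.symm, ?_⟩
    rw [integral_congr_ae h, integral_add' hf hg, hf0, hg0, add_zero]
  smul_mem' := by
    rintro c f ⟨hf, hf0⟩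
    have h := Lp.coeFn_smul c f
    refine ⟨(hf.smul c).congr h.symm, ?_⟩
    rw [integral_congr_ae h]
    simp only [Pi.smul_apply]
    rw [integral_smul, hf0, smul_zero]

/-- `H^1_⋄(Ω)`, the elements of `H^1(Ω)` whose trace on `Γ` has mean zero. -/
def H1Mean {d : ℕ} (Ω Γ : Set (EuclideanSpace ℝ (Fin d))) : Submodule ℂ (H1 Ω) :=
  (L2Mean Γ).comap (traceOp Ω Γ).toLinearMap

/-- The trace operator as a map `H^1_⋄(Ω) → L^2_⋄(Γ)`. -/
def traceMean {d : ℕ} (Ω Γ : Set (EuclideanSpace ℝ (Fin d))) : H1Mean Ω Γ →L[ℂ] L2Mean Γ :=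
  ((traceOp Ω Γ).comp (H1Mean Ω Γ).subtypeL).codRestrict (L2Mean Γ) fun w => w.2

/-! ### The continuum model -/

/-- `u` is a weak solution of `-∇·(A∇u) = 0` in `Ω` with Neumann data `f` on `Γ` and `0` on the rest
of the boundary: `⟨u, v⟩_A = ⟨f, T v⟩_{L^2(Γ)}` for all `v ∈ H^1(Ω)`. -/
def IsWeakSolution {d : ℕ} {Ω Γ : Set (EuclideanSpace ℝ (Fin d))} (A : Coeff Ω) (f : L2Mean Γ)
    (u : H1Mean Ω Γ) : Prop :=
  ∀ v : H1 Ω, coeffForm A (u : H1 Ω) v = inner ℂ (traceOp Ω Γ v) (f : L2Bd Γ)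

/-- The solution operator `N(A) : f ↦ u`. -/
def solOp {d : ℕ} (Ω Γ : Set (EuclideanSpace ℝ (Fin d))) (A : Coeff Ω) :
    L2Mean Γ →L[ℂ] H1Mean Ω Γ :=
  Classical.epsilon fun S => ∀ f : L2Mean Γ, IsWeakSolution A f (S f)

/-- The local Neumann-to-Dirichlet map `Λ(A) = T N(A)`. -/
def ndMap {d : ℕ} (Ω Γ : Set (EuclideanSpace ℝ (Fin d))) (A : Coeff Ω) :
    L2Mean Γ →L[ℂ] L2Mean Γ :=
  traceMean Ω Γ ∘L solOp Ω Γ A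

/-- `z` solves the variational problem `⟨z, v⟩_A = -⟨y, v⟩_B` for all `v ∈ H^1(Ω)`. -/
def IsPerturbSolution {d : ℕ} {Ω Γ : Set (EuclideanSpace ℝ (Fin d))} (A B : Coeff Ω)
    (y z : H1Mean Ω Γ) : Prop :=
  ∀ v : H1 Ω, coeffForm A (z : H1 Ω) v = - coeffForm B (y : H1 Ω) v

/-- The operator `P_A : L^∞(Ω; ℂ^{d×d}) → 𝓛(H^1_⋄(Ω))`. -/
def perturbOp {d : ℕ} (Ω Γ : Set (EuclideanSpace ℝ (Fin d))) (A : Coeff Ω) :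
    Coeff Ω →L[ℂ] (H1Mean Ω Γ →L[ℂ] H1Mean Ω Γ) :=
  Classical.epsilon fun P => ∀ (B : Coeff Ω) (y : H1Mean Ω Γ), IsPerturbSolution A B y (P B y)

end

/-!
Constants lie in the kernel of the forms `⟨·, ·⟩_B` and pair to zero with `L^2_⋄(Γ)`, so each of
the variational problems may be tested on `H^1_⋄(Ω)` alone and becomes an equation in that Hilbert
space: `M(A) N(A) = R`, with `R` the adjoint of the trace, and `M(A) P_A(B) = -M(B)`. The operator
`M(A)` depends linearly on `A`, hence `M(A + B) = M(A) (1 - P_A(B))`, and everything follows from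
the Neumann series of `(1 - P_A(B))⁻¹` once `M(A)` is invertible. Ellipticity gives invertibility by
Lax–Milgram, and it gives `‖∇ P_A(B) y‖ ≤ (‖B‖ / c) ‖∇ y‖`, so that the series converges for
`‖B‖ < c`.

Coercivity is the Poincaré inequality on `H^1_⋄(Ω)`. On a ball, `u` differs from its mean by at most
an average of translates `u(· + v) - u`, which the gradient controls. Translating a small ball along
segments in `Ω` carries the resulting bound through the connected set `Ω`, and an upward translation
in a graph chart carries it to the boundary. The trace is bounded because, in a graph chart, the
value of a smooth function on the graph is controlled by integrals along the vertical segment above.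
-/

open scoped Ring Topology

/-! ### Neumann series -/

theorem inverse_add_of_isUnit {R : Type*} [Ring R] {s : R} (hs : IsUnit s) (t : R) :
    (s + t)⁻¹ʳ = (1 - -(s⁻¹ʳ * t))⁻¹ʳ * s⁻¹ʳ := by
  rw [← Ring.inverse_mul (.inl hs), sub_neg_eq_add, mul_add, mul_one,
    Ring.mul_inverse_cancel_left _ _ hs]

theorem hasSum_pow_inverse_one_sub {R : Type*} [Ring R] [TopologicalSpace R] [IsTopologicalRing R]
    [T2Space R] {x : R} (h : Summable fun k : ℕ => x ^ k) :
    HasSum (fun k : ℕ => x ^ k) (1 - x)⁻¹ʳ := by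
  let u : Rˣ := ⟨1 - x, ∑' k : ℕ, x ^ k, h.one_sub_mul_tsum_pow, h.tsum_pow_mul_one_sub⟩
  have hu : (1 - x)⁻¹ʳ = ∑' k : ℕ, x ^ k := Ring.inverse_unit u
  exact hu ▸ h.hasSum

theorem apply_eq_iff_eq_inverse_apply {R M : Type*} [Semiring R] [AddCommMonoid M]
    [TopologicalSpace M] [Module R M] {S : M →L[R] M} (hS : IsUnit S) (x y : M) :
    S x = y ↔ x = S⁻¹ʳ y := by
  constructor
  · rintro rfl
    rw [← mul_apply_eq_comp, Ring.inverse_mul_cancel S hS, one_apply_eq_self]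
  · rintro rfl
    rw [← mul_apply_eq_comp, Ring.mul_inverse_cancel S hS, one_apply_eq_self]

section NeumannSeries

variable {𝕜 X H F : Type*} [NontriviallyNormedField 𝕜] [NormedAddCommGroup X] [NormedSpace 𝕜 X]
  [NormedAddCommGroup H] [NormedSpace 𝕜 H] [NormedAddCommGroup F] [NormedSpace 𝕜 F]

/-- The power series of `b ↦ (1 - P b)⁻¹ ∘ N₀` at the origin. -/
noncomputable def neumannSeries (P : X →L[𝕜] H →L[𝕜] H) (N₀ : F →L[𝕜] H) :
    FormalMultilinearSeries 𝕜 X (F →L[𝕜] H) :=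
  ((ContinuousLinearMap.compL 𝕜 F H H).flip N₀).compFormalMultilinearSeries
    ((formalMultilinearSeries_geometric 𝕜 (H →L[𝕜] H)).compContinuousLinearMap P)

theorem neumannSeries_apply (P : X →L[𝕜] H →L[𝕜] H) (N₀ : F →L[𝕜] H) (k : ℕ) (b : Fin k → X) :
    neumannSeries P N₀ k b = (List.ofFn fun i => P (b i)).prod ∘L N₀ := by
  simp [neumannSeries, formalMultilinearSeries_geometric, Function.comp_def]

/-- The perturbation operators `b ↦ -(M a)⁻¹ (M b)` of a linear family `M` of operators at `a`. -/
noncomputable def relPerturb (M : X →L[𝕜] H →L[𝕜] H) (a : X) : X →L[𝕜] H →L[𝕜] H :=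
  -(ContinuousLinearMap.compL 𝕜 H H H (M a)⁻¹ʳ ∘L M)

variable (M : X →L[𝕜] H →L[𝕜] H) (R : F →L[𝕜] H) {a : X}

theorem inverse_map_add (ha : IsUnit (M a)) (b : X) :
    (M (a + b))⁻¹ʳ = (1 - relPerturb M a b)⁻¹ʳ * (M a)⁻¹ʳ := by
  rw [map_add, inverse_add_of_isUnit ha]
  rfl

theorem hasFPowerSeriesAt_inverse_comp [CompleteSpace H] (ha : IsUnit (M a)) :
    HasFPowerSeriesAt (fun x => (M x)⁻¹ʳ ∘L R)
      (neumannSeries (relPerturb M a) ((M a)⁻¹ʳ ∘L R)) a := by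
  have geometric : HasFPowerSeriesOnBall (fun x : H →L[𝕜] H => (1 - x)⁻¹ʳ)
      (formalMultilinearSeries_geometric 𝕜 (H →L[𝕜] H)) (relPerturb M a 0) 1 := by
    rw [map_zero]
    exact hasFPowerSeriesOnBall_inverse_one_sub 𝕜 (H →L[𝕜] H)
  have translated := ((((ContinuousLinearMap.compL 𝕜 F H H).flip
    ((M a)⁻¹ʳ ∘L R)).comp_hasFPowerSeriesOnBall
      geometric.compContinuousLinearMap).comp_sub a).hasFPowerSeriesAt
  rw [zero_add] at translated
  refine translated.congr (Filter.Eventually.of_forall fun x => ?_)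
  have hx := inverse_map_add M ha (x - a)
  rw [add_sub_cancel] at hx
  change (1 - relPerturb M a (x - a))⁻¹ʳ ∘L (M a)⁻¹ʳ ∘L R = (M x)⁻¹ʳ ∘L R
  rw [hx]
  rfl

theorem iteratedFDeriv_inverse_comp [CompleteSpace H] (ha : IsUnit (M a)) (k : ℕ)
    (b : Fin k → X) :
    iteratedFDeriv 𝕜 k (fun x => (M x)⁻¹ʳ ∘L R) a b =
      (∑ α : Equiv.Perm (Fin k), (List.ofFn fun i : Fin k => relPerturb M a (b (α i))).prod) ∘L
        (M a)⁻¹ʳ ∘L R := by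
  obtain ⟨r, hr⟩ := hasFPowerSeriesAt_inverse_comp M R ha
  rw [hr.iteratedFDeriv_eq_sum_of_completeSpace]
  simp only [neumannSeries_apply]
  ext x
  simp

theorem iteratedFDeriv_inverse_comp_const [CompleteSpace H] (ha : IsUnit (M a)) (k : ℕ) (b : X) :
    iteratedFDeriv 𝕜 k (fun x => (M x)⁻¹ʳ ∘L R) a (fun _ => b) =
      k.factorial • ((relPerturb M a b ^ k) ∘L (M a)⁻¹ʳ ∘L R) := by
  rw [iteratedFDeriv_inverse_comp M R ha]
  simp only [List.ofFn_const, List.prod_replicate, Finset.sum_const, Finset.card_univ,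
    Fintype.card_perm, Fintype.card_fin, ContinuousLinearMap.smul_comp]

theorem hasSum_relPerturb_pow_comp (ha : IsUnit (M a)) {b : X}
    (hb : Summable fun k : ℕ => relPerturb M a b ^ k) :
    HasSum (fun k : ℕ => (relPerturb M a b ^ k) ∘L (M a)⁻¹ʳ ∘L R) ((M (a + b))⁻¹ʳ ∘L R) := by
  rw [inverse_map_add M ha]
  exact (hasSum_pow_inverse_one_sub hb).mapL
    ((ContinuousLinearMap.compL 𝕜 F H H).flip ((M a)⁻¹ʳ ∘L R))

theorem analyticAt_compL {G : Type*} [NormedAddCommGroup G] [NormedSpace 𝕜 G]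
    {f : X → F →L[𝕜] H} (hf : AnalyticAt 𝕜 f a) (T : H →L[𝕜] G) :
    AnalyticAt 𝕜 (fun x => T ∘L f x) a :=
  ((ContinuousLinearMap.compL 𝕜 F H G T).analyticAt _).comp hf

theorem iteratedFDeriv_compL_apply {G : Type*} [NormedAddCommGroup G] [NormedSpace 𝕜 G]
    {f : X → F →L[𝕜] H} {k : ℕ} (hf : ContDiffAt 𝕜 k f a) (T : H →L[𝕜] G) (b : Fin k → X) :
    iteratedFDeriv 𝕜 k (fun x => T ∘L f x) a b = T ∘L iteratedFDeriv 𝕜 k f a b :=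
  congrArg (· b) ((ContinuousLinearMap.compL 𝕜 F H G T).iteratedFDeriv_comp_left hf le_rfl)

theorem summable_pow_of_antilipschitzWith {V : Type*} [NormedAddCommGroup V] [NormedSpace 𝕜 V]
    [CompleteSpace H] {D : H →L[𝕜] V} {K : ℝ≥0} (hD : AntilipschitzWith K D) {P : H →L[𝕜] H}
    {q : ℝ} (hq₀ : 0 ≤ q) (hq₁ : q < 1) (hP : ∀ y, ‖D (P y)‖ ≤ q * ‖D y‖) :
    Summable fun k : ℕ => P ^ k := by
  have hpow : ∀ (k : ℕ) (y : H), ‖D ((P ^ k) y)‖ ≤ q ^ k * ‖D y‖ := by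
    intro k
    induction k with
    | zero => simp
    | succ k ih =>
      intro y
      rw [pow_succ', mul_apply_eq_comp, pow_succ', mul_assoc]
      exact (hP _).trans (mul_le_mul_of_nonneg_left (ih y) hq₀)
  refine Summable.of_norm_bounded ((summable_geometric_of_lt_one hq₀ hq₁).mul_left (K * ‖D‖))
    fun k => ContinuousLinearMap.opNorm_le_bound _ (by positivity) fun y => ?_
  calc ‖(P ^ k) y‖ ≤ K * ‖D ((P ^ k) y)‖ := D.bound_of_antilipschitz hD _
    _ ≤ K * (q ^ k * (‖D‖ * ‖y‖)) := by
        gcongr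
        exact (hpow k y).trans (by gcongr; exact D.le_opNorm y)
    _ = K * ‖D‖ * q ^ k * ‖y‖ := by ring

end NeumannSeries

section Form

variable {𝕜 X H V : Type*} [RCLike 𝕜] [NormedAddCommGroup X] [NormedSpace 𝕜 X]
  [NormedAddCommGroup H] [InnerProductSpace 𝕜 H] [CompleteSpace H]
  [NormedAddCommGroup V] [InnerProductSpace 𝕜 V]

theorem isUnit_of_coercive {S : H →L[𝕜] H} {D : H →L[𝕜] V} {K : ℝ≥0} (hD : AntilipschitzWith K D)
    {c : ℝ} (hc : 0 < c) (hS : ∀ u, c * ‖D u‖ ^ 2 ≤ RCLike.re (inner 𝕜 u (S u))) : IsUnit S := by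
  have hpos : 0 < c / (K + 1) ^ 2 := by positivity
  refine ContinuousLinearMap.isUnit_of_forall_le_norm_inner_map S
    (Real.toNNReal_pos.2 hpos) fun u => ?_
  have hu : ‖u‖ ^ 2 ≤ (K + 1) ^ 2 * ‖D u‖ ^ 2 := by
    rw [← mul_pow]
    gcongr
    refine (D.bound_of_antilipschitz hD u).trans ?_
    gcongr
    linarith
  rw [Real.coe_toNNReal _ hpos.le, norm_inner_symm]
  calc ‖u‖ ^ 2 * (c / (K + 1) ^ 2) ≤ (K + 1) ^ 2 * ‖D u‖ ^ 2 * (c / (K + 1) ^ 2) := by gcongr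
    _ = c * ‖D u‖ ^ 2 := by field_simp
    _ ≤ RCLike.re (inner 𝕜 u (S u)) := hS u
    _ ≤ ‖inner 𝕜 u (S u)‖ := RCLike.re_le_norm _

variable [CompleteSpace V]

/-- The operators representing the sesquilinear forms `(w, v) ↦ ⟨D v, m b (D w)⟩`. -/
noncomputable def sandwich (D : H →L[𝕜] V) (m : X →L[𝕜] V →L[𝕜] V) : X →L[𝕜] H →L[𝕜] H :=
  ContinuousLinearMap.compL 𝕜 H V H (ContinuousLinearMap.adjoint D) ∘L
    (ContinuousLinearMap.compL 𝕜 H V V).flip D ∘L m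

theorem inner_sandwich (D : H →L[𝕜] V) (m : X →L[𝕜] V →L[𝕜] V) (b : X) (w v : H) :
    inner 𝕜 v (sandwich D m b w) = inner 𝕜 (D v) (m b (D w)) := by
  rw [← ContinuousLinearMap.adjoint_inner_right]
  rfl

variable {D : H →L[𝕜] V} {K : ℝ≥0} (hD : AntilipschitzWith K D) {m : X →L[𝕜] V →L[𝕜] V} {a : X}
  {c : ℝ} (hc : 0 < c) (hm : ∀ g, c * ‖g‖ ^ 2 ≤ RCLike.re (inner 𝕜 g (m a g)))
include hD hc hm

theorem isUnit_sandwich : IsUnit (sandwich D m a) :=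
  isUnit_of_coercive hD hc fun u => by
    rw [inner_sandwich]
    exact hm (D u)

theorem norm_apply_relPerturb_sandwich_le (b : X) (y : H) :
    ‖D (relPerturb (sandwich D m) a b y)‖ ≤ ‖m b‖ / c * ‖D y‖ := by
  set z := relPerturb (sandwich D m) a b y with hz
  have hz' : sandwich D m a z = -sandwich D m b y := by
    rw [apply_eq_iff_eq_inverse_apply (isUnit_sandwich hD hc hm), map_neg]
    exact hz
  have form_eq : inner 𝕜 (D z) (m a (D z)) = -inner 𝕜 (D z) (m b (D y)) := by
    rw [← inner_sandwich, hz', inner_neg_right, inner_sandwich]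
  have energy : c * ‖D z‖ ^ 2 ≤ ‖D z‖ * (‖m b‖ * ‖D y‖) :=
    calc c * ‖D z‖ ^ 2 ≤ RCLike.re (inner 𝕜 (D z) (m a (D z))) := hm (D z)
      _ ≤ ‖inner 𝕜 (D z) (m b (D y))‖ := by
          rw [form_eq, ← norm_neg]
          exact RCLike.re_le_norm _
      _ ≤ ‖D z‖ * (‖m b‖ * ‖D y‖) :=
          (norm_inner_le_norm _ _).trans (by gcongr; exact (m b).le_opNorm _)
  rcases (norm_nonneg (D z)).eq_or_lt with h0 | h0
  · rw [← h0]
    positivity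
  · rw [div_mul_eq_mul_div, le_div_iff₀ hc]
    nlinarith

theorem summable_relPerturb_sandwich_pow {b : X} (hb : ‖m b‖ < c) :
    Summable fun k : ℕ => relPerturb (sandwich D m) a b ^ k :=
  summable_pow_of_antilipschitzWith hD (by positivity) ((div_lt_one hc).2 hb)
    (norm_apply_relPerturb_sandwich_le hD hc hm b)

end Form

/-! ### The Hilbert space `H^1(Ω)` -/

theorem continuous_integral_bilinear {α 𝕜 E F G : Type*} {m : MeasurableSpace α} {μ : Measure α}
    [NontriviallyNormedField 𝕜] [NormedAddCommGroup E] [NormedSpace 𝕜 E] [NormedAddCommGroup F]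
    [NormedSpace 𝕜 F] [NormedAddCommGroup G] [NormedSpace 𝕜 G] [NormedSpace ℝ G]
    [SMulCommClass ℝ 𝕜 G] [CompleteSpace G] {p q : ℝ≥0∞} [Fact (1 ≤ p)] [Fact (1 ≤ q)]
    [p.HolderConjugate q] (B : E →L[𝕜] F →L[𝕜] G) {f : α → E} (hf : MemLp f p μ) :
    Continuous fun u : Lp F q μ => ∫ x, B (f x) (u x) ∂μ := by
  refine (B.lpPairing μ p q (hf.toLp f)).continuous.congr fun u => ?_
  rw [ContinuousLinearMap.lpPairing_eq_integral]
  refine integral_congr_ae ?_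
  filter_upwards [hf.coeFn_toLp] with x hx
  rw [hx]

theorem re_inner_L2_eq_integral {α 𝕜 E : Type*} {m : MeasurableSpace α} {μ : Measure α}
    [RCLike 𝕜] [NormedAddCommGroup E] [InnerProductSpace 𝕜 E] (g h : Lp E 2 μ) :
    RCLike.re (inner 𝕜 g h) = ∫ x, RCLike.re (inner 𝕜 (g x) (h x)) ∂μ := by
  rw [L2.inner_def]
  exact (integral_re (L2.integrable_inner g h)).symm

theorem ae_norm_le_norm_Linfty {α E : Type*} {m : MeasurableSpace α} {μ : Measure α}
    [NormedAddCommGroup E] (f : Lp E ∞ μ) : ∀ᵐ x ∂μ, ‖f x‖ ≤ ‖f‖ := by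
  filter_upwards [ae_le_eLpNormEssSup (f := f) (μ := μ)] with x hx
  rwa [← eLpNorm_exponent_top, ← Lp.enorm_def, enorm_le_iff_norm_le] at hx

section Sobolev

variable {d : ℕ} {Ω : Set (EuclideanSpace ℝ (Fin d))}

theorem isClosed_weakGradientGraph :
    IsClosed (weakGradientGraph Ω : Set (WithLp 2 (L2Dom Ω × L2VecDom Ω))) := by
  have inter : (weakGradientGraph Ω : Set (WithLp 2 (L2Dom Ω × L2VecDom Ω))) =
      ⋂ (φ : EuclideanSpace ℝ (Fin d) → ℝ) (_ : ContDiff ℝ ∞ φ) (_ : HasCompactSupport φ)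
        (_ : tsupport φ ⊆ Ω) (i : Fin d),
        {w | ∫ x in Ω, (fderiv ℝ φ x (EuclideanSpace.single i 1)) • w.fst x =
          - ∫ x in Ω, φ x • w.snd x i} := by
    ext w
    simp only [Set.mem_iInter]
    rfl
  rw [inter]
  refine isClosed_iInter fun φ => isClosed_iInter fun hφ => isClosed_iInter fun hc =>
    isClosed_iInter fun _ => isClosed_iInter fun i => isClosed_eq ?_ (Continuous.neg ?_)
  · have hφ' : Continuous fun x => fderiv ℝ φ x (EuclideanSpace.single i 1) :=
      (hφ.continuous_fderiv (by simp)).clm_apply continuous_const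
    exact (continuous_integral_bilinear (p := 2) (ContinuousLinearMap.lsmul ℝ ℝ)
      ((hφ'.memLp_of_hasCompactSupport (hc.fderiv_apply (𝕜 := ℝ) _)).restrict Ω)).comp
        (WithLp.continuous_fst 2 _ _)
  · let coord : EuclideanSpace ℂ (Fin d) →L[ℝ] ℂ :=
      (EuclideanSpace.proj i : EuclideanSpace ℂ (Fin d) →L[ℂ] ℂ).restrictScalars ℝ
    exact (continuous_integral_bilinear (p := 2)
      ((ContinuousLinearMap.lsmul ℝ ℝ : ℝ →L[ℝ] ℂ →L[ℝ] ℂ).bilinearComp (.id ℝ ℝ) coord)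
      ((hφ.continuous.memLp_of_hasCompactSupport hc).restrict Ω)).comp
        (WithLp.continuous_snd 2 _ _)

instance : CompleteSpace (H1 Ω) :=
  (isClosed_weakGradientGraph (Ω := Ω)).completeSpace_coe

/-- The weak gradient as a bounded operator on `H^1(Ω)`. -/
noncomputable def gradL (Ω : Set (EuclideanSpace ℝ (Fin d))) : H1 Ω →L[ℂ] L2VecDom Ω :=
  (WithLp.sndL 2 ℂ (L2Dom Ω) (L2VecDom Ω)).comp (weakGradientGraph Ω).subtypeL

theorem gradL_apply (w : H1 Ω) : gradL Ω w = H1.grad w := rfl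

/-- The inclusion of `H^1(Ω)` in `L^2(Ω)`. -/
noncomputable def toFunL (Ω : Set (EuclideanSpace ℝ (Fin d))) : H1 Ω →L[ℂ] L2Dom Ω :=
  (WithLp.fstL 2 ℂ (L2Dom Ω) (L2VecDom Ω)).comp (weakGradientGraph Ω).subtypeL

theorem toFunL_apply (w : H1 Ω) : toFunL Ω w = H1.toFun w := rfl

theorem H1.norm_sq_eq (w : H1 Ω) : ‖w‖ ^ 2 = ‖H1.toFun w‖ ^ 2 + ‖H1.grad w‖ ^ 2 :=
  WithLp.prod_norm_sq_eq_of_L2 _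

theorem integral_fderiv_apply_eq_zero {E : Type*} [NormedAddCommGroup E] [NormedSpace ℝ E]
    [FiniteDimensional ℝ E] [MeasurableSpace E] [BorelSpace E] {μ : Measure E} [μ.IsAddHaarMeasure]
    {φ : E → ℝ} (hφ : ContDiff ℝ 1 φ) (hc : HasCompactSupport φ) (v : E) :
    ∫ x, fderiv ℝ φ x v ∂μ = 0 := by
  have hφ' : Continuous fun x => fderiv ℝ φ x v :=
    (hφ.continuous_fderiv one_ne_zero).clm_apply continuous_const
  have parts := integral_mul_fderiv_eq_neg_fderiv_mul_of_integrable (μ := μ)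
    (f := fun _ : E => (1 : ℝ)) (g := φ) (v := v) (by simp)
    (by simpa using hφ'.integrable_of_hasCompactSupport (hc.fderiv_apply (𝕜 := ℝ) v))
    (by simpa using hφ.continuous.integrable_of_hasCompactSupport hc)
    (by simp) (fun x _ => (hφ.differentiable one_ne_zero).differentiableAt)
  simpa using parts

section Constants

variable [IsFiniteMeasure ((volume : Measure (EuclideanSpace ℝ (Fin d))).restrict Ω)]

theorem isWeakGradient_const (c : ℂ) :
    IsWeakGradient (Lp.const 2 (volume.restrict Ω) c : L2Dom Ω) 0 := by
  intro φ hφ hc hs i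
  have left : ∫ x in Ω, (fderiv ℝ φ x (EuclideanSpace.single i 1)) •
      (Lp.const 2 (volume.restrict Ω) c : L2Dom Ω) x = 0 := by
    calc ∫ x in Ω, (fderiv ℝ φ x (EuclideanSpace.single i 1)) •
          (Lp.const 2 (volume.restrict Ω) c : L2Dom Ω) x
        = ∫ x in Ω, (fderiv ℝ φ x (EuclideanSpace.single i 1)) • c := by
          refine integral_congr_ae ?_
          filter_upwards [Lp.coeFn_const 2 (volume.restrict Ω) c] with x hx
          rw [hx, Function.const_apply]
      _ = 0 := by
          rw [integral_smul_const, setIntegral_eq_integral_of_forall_compl_eq_zero,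
            integral_fderiv_apply_eq_zero (hφ.of_le (by simp)) hc, zero_smul]
          intro x hx
          rw [fderiv_of_notMem_tsupport ℝ (fun h => hx (hs h)), zero_apply]
  have right : ∫ x in Ω, φ x • (0 : L2VecDom Ω) x i = 0 := by
    refine integral_eq_zero_of_ae ?_
    filter_upwards [Lp.coeFn_zero (EuclideanSpace ℂ (Fin d)) 2 (volume.restrict Ω)] with x hx
    rw [hx]
    simp
  rw [left, right, neg_zero]

variable (Ω) in
/-- The constant functions in `H^1(Ω)`, for a set `Ω` of finite measure. -/
noncomputable def H1.constL : ℂ →L[ℂ] H1 Ω :=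
  ((WithLp.prodContinuousLinearEquiv 2 ℂ (L2Dom Ω) (L2VecDom Ω)).symm.toContinuousLinearMap ∘L
    (Lp.constL 2 (volume.restrict Ω) ℂ).prod 0).codRestrict (weakGradientGraph Ω)
      isWeakGradient_const

theorem H1.grad_constL (c : ℂ) : H1.grad (H1.constL Ω c) = 0 := rfl

theorem H1.toFun_constL (c : ℂ) :
    H1.toFun (H1.constL Ω c) = Lp.const 2 (volume.restrict Ω) c := rfl

theorem H1.grad_sub_constL (w : H1 Ω) (c : ℂ) : H1.grad (w - H1.constL Ω c) = H1.grad w := by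
  rw [← gradL_apply, map_sub, gradL_apply (H1.constL _ _), H1.grad_constL, sub_zero, gradL_apply]

theorem H1.toFun_sub_constL_ae_eq (w : H1 Ω) (c : ℂ) :
    H1.toFun (w - H1.constL Ω c) =ᵐ[volume.restrict Ω] fun x => H1.toFun w x - c := by
  rw [← toFunL_apply, map_sub, toFunL_apply, toFunL_apply, H1.toFun_constL]
  filter_upwards [Lp.coeFn_sub (H1.toFun w) (Lp.const 2 (volume.restrict Ω) c),
    Lp.coeFn_const 2 (volume.restrict Ω) c] with x hsub hconst
  rw [hsub, Pi.sub_apply, hconst, Function.const_apply]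

end Constants

/-! ### Coefficients and ellipticity -/

/-- The action of complex matrices on `ℂ^d` as a bounded bilinear map. -/
noncomputable def matActL (d : ℕ) : Matrix (Fin d) (Fin d) ℂ →L[ℂ]
    EuclideanSpace ℂ (Fin d) →L[ℂ] EuclideanSpace ℂ (Fin d) :=
  LinearMap.mkContinuous
    (Matrix.toEuclideanCLM (n := Fin d) (𝕜 := ℂ)).toAlgEquiv.toLinearMap 1
    fun M => by rw [one_mul]; exact (Matrix.l2_opNorm_toEuclideanCLM M).le

theorem matActL_apply (M : Matrix (Fin d) (Fin d) ℂ) (ξ : EuclideanSpace ℂ (Fin d)) :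
    matActL d M ξ = matAct M ξ := rfl

theorem norm_matAct_le (M : Matrix (Fin d) (Fin d) ℂ) (ξ : EuclideanSpace ℂ (Fin d)) :
    ‖matAct M ξ‖ ≤ ‖M‖ * ‖ξ‖ := M.l2_opNorm_mulVec ξ

theorem norm_matActL_le : ‖matActL d‖ ≤ 1 := LinearMap.mkContinuous_norm_le _ zero_le_one _

/-- Multiplication of vector fields by a coefficient. -/
noncomputable def coeffMul (Ω : Set (EuclideanSpace ℝ (Fin d))) :
    Coeff Ω →L[ℂ] L2VecDom Ω →L[ℂ] L2VecDom Ω :=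
  (matActL d).holderL (volume.restrict Ω) ∞ 2 2

theorem coeffMul_ae (B : Coeff Ω) (g : L2VecDom Ω) :
    coeffMul Ω B g =ᵐ[volume.restrict Ω] fun x => matAct (B x) (g x) :=
  (matActL d).coeFn_holder B g

theorem norm_coeffMul_apply_le (B : Coeff Ω) (g : L2VecDom Ω) :
    ‖coeffMul Ω B g‖ ≤ ‖B‖ * ‖g‖ := by
  refine ((matActL d).norm_holder_apply_apply_le B g).trans ?_
  gcongr
  exact mul_le_of_le_one_left (norm_nonneg B) norm_matActL_le

theorem coeffForm_eq_inner (B : Coeff Ω) (w v : H1 Ω) :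
    coeffForm B w v = inner ℂ (H1.grad v) (coeffMul Ω B (H1.grad w)) := by
  rw [L2.inner_def]
  refine integral_congr_ae ?_
  filter_upwards [coeffMul_ae B (H1.grad w)] with x hx
  rw [hx]

theorem IsEllipticityConst.ae_forall {A : Coeff Ω} {c : ℝ} (h : IsEllipticityConst A c) :
    ∀ᵐ x ∂(volume.restrict Ω), ∀ ξ : EuclideanSpace ℂ (Fin d),
      c * ‖ξ‖ ^ 2 ≤ (inner ℂ ξ (matAct (A x) ξ)).re := by
  let ξ₀ := TopologicalSpace.denseSeq (EuclideanSpace ℂ (Fin d))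
  have on_seq : ∀ᵐ x ∂(volume.restrict Ω), ∀ n : ℕ,
      c * ‖ξ₀ n‖ ^ 2 ≤ (inner ℂ (ξ₀ n) (matAct (A x) (ξ₀ n))).re := ae_all_iff.2 fun n => h _
  filter_upwards [on_seq] with x hx
  refine isClosed_property (TopologicalSpace.denseRange_denseSeq _) ?_ hx
  exact isClosed_le (by fun_prop)
    (Complex.continuous_re.comp (continuous_id.inner (matActL d (A x)).continuous))

theorem IsEllipticityConst.le_re_inner {A : Coeff Ω} {c : ℝ} (h : IsEllipticityConst A c)
    (g : L2VecDom Ω) : c * ‖g‖ ^ 2 ≤ (inner ℂ g (coeffMul Ω A g)).re := by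
  have norm_sq : ‖g‖ ^ 2 = ∫ x in Ω, ‖g x‖ ^ 2 := by
    rw [← inner_self_eq_norm_sq (𝕜 := ℂ) g, re_inner_L2_eq_integral]
    simp only [inner_self_eq_norm_sq]
  calc c * ‖g‖ ^ 2 = ∫ x in Ω, c * ‖g x‖ ^ 2 := by rw [norm_sq, integral_const_mul]
    _ ≤ ∫ x in Ω, (inner ℂ (g x) (coeffMul Ω A g x)).re := by
        refine integral_mono_ae (((Lp.memLp g).integrable_norm_pow two_ne_zero).const_mul c)
          (L2.integrable_inner (𝕜 := ℂ) g (coeffMul Ω A g)).re ?_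
        filter_upwards [h.ae_forall, coeffMul_ae A g] with x hx hmul
        rw [hmul]
        exact hx (g x)
    _ = (inner ℂ g (coeffMul Ω A g)).re := 
        (re_inner_L2_eq_integral (𝕜 := ℂ) g (coeffMul Ω A g)).symm

theorem IsEllipticityConst.add {A : Coeff Ω} {c : ℝ} (h : IsEllipticityConst A c) (B : Coeff Ω) :
    IsEllipticityConst (A + B) (c - ‖B‖) := by
  intro ξ
  filter_upwards [h ξ, ae_norm_le_norm_Linfty B, Lp.coeFn_add A B] with x hA hB hAB
  have split : inner ℂ ξ (matAct ((A + B : Coeff Ω) x) ξ) =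
      inner ℂ ξ (matAct (A x) ξ) + inner ℂ ξ (matAct (B x) ξ) := by
    rw [hAB, Pi.add_apply, ← matActL_apply, map_add, add_apply, inner_add_right]
    rfl
  have perturbation : |(inner ℂ ξ (matAct (B x) ξ)).re| ≤ ‖B‖ * ‖ξ‖ ^ 2 := by
    calc |(inner ℂ ξ (matAct (B x) ξ)).re| ≤ ‖inner ℂ ξ (matAct (B x) ξ)‖ :=
          Complex.abs_re_le_norm _
      _ ≤ ‖ξ‖ * ‖matAct (B x) ξ‖ := norm_inner_le_norm _ _
      _ ≤ ‖ξ‖ * (‖B‖ * ‖ξ‖) := by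
          gcongr
          exact (norm_matAct_le (B x) ξ).trans (by gcongr)
      _ = ‖B‖ * ‖ξ‖ ^ 2 := by ring
  rw [split, Complex.add_re]
  linarith [neg_abs_le (inner ℂ ξ (matAct (B x) ξ)).re]

theorem isOpen_ellipticCoeff : IsOpen (ellipticCoeff Ω) := by
  rw [Metric.isOpen_iff]
  rintro A ⟨c, hc, hA⟩
  refine ⟨c, hc, fun A' hA' => ⟨c - ‖A' - A‖, ?_, ?_⟩⟩
  · rwa [sub_pos, ← dist_eq_norm]
  · simpa only [add_sub_cancel] using hA.add (A' - A)

end Sobolev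

/-! ### Duality with test functions -/

theorem inner_toLp_eq_integral_mul {α : Type*} [MeasurableSpace α] {μ : Measure α} {f ψ : α → ℝ}
    (hf : MemLp f 2 μ) {g : Lp ℝ 2 μ} (hg : g =ᵐ[μ] ψ) :
    inner ℝ g (hf.toLp f) = ∫ x, ψ x * f x ∂μ := by
  rw [L2.inner_def]
  refine integral_congr_ae ?_
  filter_upwards [hg, hf.coeFn_toLp] with x hx hx'
  rw [hx, hx']
  exact mul_comm _ _

section TestFunctions

variable {E : Type*} [NormedAddCommGroup E] [NormedSpace ℝ E] [FiniteDimensional ℝ E]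
  [MeasurableSpace E] [BorelSpace E] {μ : Measure E} [IsFiniteMeasureOnCompacts μ] {S : Set E}

variable (μ S) in
/-- The subspace of `L^2(S)` formed by the smooth functions with compact support in `S`. -/
noncomputable def testSubmodule : Submodule ℝ (Lp ℝ 2 (μ.restrict S)) where
  carrier := {g | ∃ ψ : E → ℝ, ContDiff ℝ ∞ ψ ∧ HasCompactSupport ψ ∧ tsupport ψ ⊆ S ∧
    g =ᵐ[μ.restrict S] ψ}
  zero_mem' := ⟨0, contDiff_const, HasCompactSupport.zero, by simp [tsupport], Lp.coeFn_zero _ _ _⟩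
  add_mem' := by
    rintro f g ⟨φ, hφ, hφc, hφS, hf⟩ ⟨ψ, hψ, hψc, hψS, hg⟩
    exact ⟨φ + ψ, hφ.add hψ, hφc.add hψc, (tsupport_add φ ψ).trans (Set.union_subset hφS hψS),
      (Lp.coeFn_add f g).trans (hf.add hg)⟩
  smul_mem' := by
    rintro c f ⟨φ, hφ, hφc, hφS, hf⟩
    exact ⟨c • φ, hφ.const_smul c, hφc.smul_left (f := fun _ => c),
      (closure_mono (Function.support_const_smul_subset c φ)).trans hφS,
      (Lp.coeFn_smul c f).trans (hf.const_smul c)⟩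

theorem topologicalClosure_testSubmodule (hS : IsOpen S) :
    (testSubmodule μ S).topologicalClosure = ⊤ := by
  rw [Submodule.topologicalClosure_eq_top_iff, Submodule.eq_bot_iff]
  intro f hf
  rw [Lp.eq_zero_iff_ae_eq_zero]
  refine (ae_restrict_iff' hS.measurableSet).2
    (hS.ae_eq_zero_of_integral_contDiff_smul_eq_zero
      (locallyIntegrableOn_of_locallyIntegrable_restrict
        ((Lp.memLp f).locallyIntegrable (by norm_num))) fun ψ hψ hψc hψS => ?_)
  have hψ2 := (hψ.continuous.memLp_of_hasCompactSupport (p := 2) (μ := μ) hψc).restrict S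
  have orthogonal := (Submodule.mem_orthogonal _ _).1 hf (hψ2.toLp ψ)
    ⟨ψ, hψ, hψc, hψS, hψ2.coeFn_toLp⟩
  rw [← Lp.toLp_coeFn f (Lp.memLp f), inner_toLp_eq_integral_mul _ hψ2.coeFn_toLp] at orthogonal
  rw [← setIntegral_eq_integral_of_forall_compl_eq_zero (s := S)]
  · exact orthogonal
  · intro x hx
    rw [image_eq_zero_of_notMem_tsupport fun h => hx (hψS h), zero_smul]

theorem eLpNorm_real_le_of_forall_test (hS : IsOpen S) {f : E → ℝ} (hf : MemLp f 2 (μ.restrict S))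
    {M : ℝ≥0} (h : ∀ ψ : E → ℝ, ContDiff ℝ ∞ ψ → HasCompactSupport ψ → tsupport ψ ⊆ S →
      |∫ x in S, ψ x * f x ∂μ| ≤ M * (eLpNorm ψ 2 (μ.restrict S)).toReal) :
    eLpNorm f 2 (μ.restrict S) ≤ M := by
  have bounded (g : Lp ℝ 2 (μ.restrict S)) : |inner ℝ g (hf.toLp f)| ≤ M * ‖g‖ := by
    have hg : g ∈ closure (testSubmodule μ S : Set (Lp ℝ 2 (μ.restrict S))) := by
      rw [← Submodule.topologicalClosure_coe, topologicalClosure_testSubmodule hS]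
      trivial
    refine closure_minimal ?_ (isClosed_le (f := fun g => |inner ℝ g (hf.toLp f)|)
      (g := fun g => M * ‖g‖) (by fun_prop) (by fun_prop)) hg
    rintro g ⟨ψ, hψ, hψc, hψS, hgψ⟩
    rw [Set.mem_ofPred_eq, inner_toLp_eq_integral_mul hf hgψ, Lp.norm_def, eLpNorm_congr_ae hgψ]
    exact h ψ hψ hψc hψS
  have self := bounded (hf.toLp f)
  rw [real_inner_self_eq_norm_sq, abs_of_nonneg (sq_nonneg _), sq] at self
  have norm_le : ‖hf.toLp f‖ ≤ M := by
    rcases (norm_nonneg (hf.toLp f)).eq_or_lt with h0 | h0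
    · exact h0 ▸ M.2
    · exact le_of_mul_le_mul_right self h0
  rw [Lp.norm_toLp] at norm_le
  simpa using (ENNReal.le_ofReal_iff_toReal_le hf.2.ne M.2).2 norm_le

theorem eLpNorm_le_of_forall_test (hS : IsOpen S) {f : E → ℂ} (hf : MemLp f 2 (μ.restrict S))
    {M : ℝ≥0} (h : ∀ ψ : E → ℝ, ContDiff ℝ ∞ ψ → HasCompactSupport ψ → tsupport ψ ⊆ S →
      ‖∫ x in S, ψ x • f x ∂μ‖ ≤ M * (eLpNorm ψ 2 (μ.restrict S)).toReal) :
    eLpNorm f 2 (μ.restrict S) ≤ 2 * M := by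
  have part (L : ℂ →L[ℝ] ℝ) (hL : ∀ z, |L z| ≤ ‖z‖) :
      eLpNorm (fun x => L (f x)) 2 (μ.restrict S) ≤ M := by
    refine eLpNorm_real_le_of_forall_test hS (L.comp_memLp' hf) fun ψ hψ hψc hψS => ?_
    have integrable : Integrable (fun x => ψ x • f x) (μ.restrict S) := memLp_one_iff_integrable.1
      (hf.smul ((hψ.continuous.memLp_of_hasCompactSupport (p := 2) (μ := μ) hψc).restrict S))
    have pairing : ∫ x in S, ψ x * L (f x) ∂μ = L (∫ x in S, ψ x • f x ∂μ) := by
      simp only [← L.integral_comp_comm integrable, map_smul, smul_eq_mul]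
    exact (congrArg abs pairing).trans_le ((hL _).trans (h ψ hψ hψc hψS))
  have re_le := part Complex.reCLM Complex.abs_re_le_norm
  have im_le := part Complex.imCLM Complex.abs_im_le_norm
  rw [← eLpNorm_norm] at re_le im_le
  calc eLpNorm f 2 (μ.restrict S)
      ≤ eLpNorm ((fun x => ‖Complex.reCLM (f x)‖) + fun x => ‖Complex.imCLM (f x)‖) 2
          (μ.restrict S) := eLpNorm_mono_real fun x => Complex.norm_le_abs_re_add_abs_im (f x)
    _ ≤ M + M := (eLpNorm_add_le hf.re.1.norm hf.im.1.norm (by norm_num)).trans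
          (add_le_add re_le im_le)
    _ = 2 * M := (two_mul _).symm

end TestFunctions

theorem enorm_integral_smul_le {α F : Type*} [MeasurableSpace α] {μ : Measure α}
    [NormedAddCommGroup F] [NormedSpace ℝ F] {φ : α → ℝ} {f : α → F}
    (hφ : AEStronglyMeasurable φ μ) (hf : AEStronglyMeasurable f μ) :
    ‖∫ x, φ x • f x ∂μ‖ₑ ≤ eLpNorm φ 2 μ * eLpNorm f 2 μ :=
  (enorm_integral_le_lintegral_enorm _).trans <|
    eLpNorm_one_eq_lintegral_enorm.symm.trans_le (eLpNorm_smul_le_mul_eLpNorm hf hφ)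

/-! ### Translations -/

section Translation

variable {d : ℕ} {Ω : Set (EuclideanSpace ℝ (Fin d))}

/-- The directional derivative `v · g` of a function with gradient `g`. -/
noncomputable def dirDeriv (v : EuclideanSpace ℝ (Fin d))
    (g : EuclideanSpace ℝ (Fin d) → EuclideanSpace ℂ (Fin d))
    (x : EuclideanSpace ℝ (Fin d)) : ℂ := ∑ i, (v i) • g x i

theorem norm_dirDeriv_le (v : EuclideanSpace ℝ (Fin d))
    (g : EuclideanSpace ℝ (Fin d) → EuclideanSpace ℂ (Fin d)) (x : EuclideanSpace ℝ (Fin d)) :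
    ‖dirDeriv v g x‖ ≤ ‖v‖ * ‖g x‖ := by
  refine (norm_sum_le _ _).trans ?_
  simp only [norm_smul]
  rw [EuclideanSpace.norm_eq, EuclideanSpace.norm_eq]
  exact Real.sum_mul_le_sqrt_mul_sqrt _ _ _

theorem map_eq_sum_smul_map_single {F : Type*} [NormedAddCommGroup F] [NormedSpace ℝ F]
    (L : EuclideanSpace ℝ (Fin d) →L[ℝ] F) (v : EuclideanSpace ℝ (Fin d)) :
    L v = ∑ i, v i • L (EuclideanSpace.single i 1) := by
  conv_lhs => rw [← (EuclideanSpace.basisFun (Fin d) ℝ).sum_repr v, map_sum]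
  simp

theorem IsWeakGradient.integral_fderiv_smul {u : L2Dom Ω} {g : L2VecDom Ω}
    (h : IsWeakGradient u g) {φ : EuclideanSpace ℝ (Fin d) → ℝ} (hφ : ContDiff ℝ ∞ φ)
    (hc : HasCompactSupport φ) (hs : tsupport φ ⊆ Ω) (v : EuclideanSpace ℝ (Fin d)) :
    ∫ x in Ω, (fderiv ℝ φ x v) • u x = - ∫ x in Ω, φ x • dirDeriv v g x := by
  have continuous_partial (i : Fin d) :
      Continuous fun x => fderiv ℝ φ x (EuclideanSpace.single i (1 : ℝ)) :=
    (hφ.continuous_fderiv (by simp)).clm_apply continuous_const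
  simp only [map_eq_sum_smul_map_single (fderiv ℝ φ _) v, Finset.sum_smul, smul_eq_mul,
    dirDeriv, Finset.smul_sum, mul_smul, smul_comm (φ _)]
  rw [integral_finsetSum, integral_finsetSum, ← Finset.sum_neg_distrib]
  · refine Finset.sum_congr rfl fun i _ => ?_
    rw [integral_smul, integral_smul, h φ hφ hc hs i, smul_neg]
  · exact fun i _ => (integrable_smul_L2Dom hφ.continuous hc (memLp_coord g i)).smul (v i)
  · exact fun i _ => (integrable_smul_L2Dom (continuous_partial i) (hc.fderiv_apply (𝕜 := ℝ) _)
      (Lp.memLp u)).smul (v i)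

theorem norm_integral_smul_dirDeriv_le {g : L2VecDom Ω} {φ : EuclideanSpace ℝ (Fin d) → ℝ}
    (hφ : Continuous φ) (hc : HasCompactSupport φ) (v : EuclideanSpace ℝ (Fin d)) :
    ‖∫ x in Ω, φ x • dirDeriv v g x‖ ≤ ‖v‖ * ‖g‖ * (eLpNorm φ 2 volume).toReal := by
  have hφ2 := hφ.memLp_of_hasCompactSupport (p := 2) (μ := volume) hc
  have measurable : AEStronglyMeasurable (dirDeriv v g) (volume.restrict Ω) :=
    Finset.aestronglyMeasurable_fun_sum _ fun i _ => (memLp_coord g i).1.const_smul (v i)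
  have dirDeriv_le : eLpNorm (dirDeriv v g) 2 (volume.restrict Ω) ≤ ‖v‖ₑ * ‖g‖ₑ := by
    rw [Lp.enorm_def, enorm_eq_nnnorm v]
    exact eLpNorm_le_nnreal_smul_eLpNorm_of_ae_le_mul (c := ‖v‖₊)
      (Filter.Eventually.of_forall fun x => norm_dirDeriv_le v g x) 2
  have enorm_le : ‖∫ x in Ω, φ x • dirDeriv v g x‖ₑ ≤ eLpNorm φ 2 volume * (‖v‖ₑ * ‖g‖ₑ) :=
    (enorm_integral_smul_le (hφ2.restrict Ω).1 measurable).trans <|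
      mul_le_mul' (eLpNorm_mono_measure _ Measure.restrict_le_self) dirDeriv_le
  have := ENNReal.toReal_mono (ENNReal.mul_ne_top hφ2.2.ne
    (ENNReal.mul_ne_top enorm_ne_top enorm_ne_top)) enorm_le
  simp only [ENNReal.toReal_mul, toReal_enorm] at this
  linarith

theorem IsWeakGradient.norm_integral_fderiv_smul_le {u : L2Dom Ω} {g : L2VecDom Ω}
    (h : IsWeakGradient u g) {φ : EuclideanSpace ℝ (Fin d) → ℝ} (hφ : ContDiff ℝ ∞ φ)
    (hc : HasCompactSupport φ) (hs : tsupport φ ⊆ Ω) (v : EuclideanSpace ℝ (Fin d)) :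
    ‖∫ x in Ω, (fderiv ℝ φ x v) • u x‖ ≤ ‖v‖ * ‖g‖ * (eLpNorm φ 2 volume).toReal := by
  rw [h.integral_fderiv_smul hφ hc hs, norm_neg]
  exact norm_integral_smul_dirDeriv_le hφ.continuous hc v

theorem hasDerivAt_integral_comp_sub_smul {E F : Type*} [NormedAddCommGroup E] [NormedSpace ℝ E]
    [MeasurableSpace E] [BorelSpace E] {μ : Measure E} [SFinite μ] [μ.IsAddLeftInvariant]
    [NormedAddCommGroup F] [NormedSpace ℝ F] {U : E → F}
    (hU : LocallyIntegrable U μ) {ψ : E → ℝ} (hψ : ContDiff ℝ 1 ψ) (hc : HasCompactSupport ψ)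
    (v : E) (t : ℝ) :
    HasDerivAt (fun t : ℝ => ∫ x, ψ (x - t • v) • U x ∂μ)
      (- ∫ x, fderiv ℝ ψ (x - t • v) v • U x ∂μ) t := by
  let L : F →L[ℝ] ℝ →L[ℝ] F := (ContinuousLinearMap.lsmul ℝ ℝ).flip
  let ρ : E → ℝ := fun z => ψ (-z)
  have hρ : ContDiff ℝ 1 ρ := hψ.comp contDiff_neg
  have hρc : HasCompactSupport ρ := hc.comp_homeomorph (Homeomorph.neg E)
  have fderiv_ρ (z : E) : fderiv ℝ ρ z = -fderiv ℝ ψ (-z) :=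
    ((hψ.differentiable one_ne_zero (-z)).hasFDerivAt.comp z (hasFDerivAt_id z).neg).fderiv.trans
      (by ext; simp)
  have integrable : Integrable (fun x => L.precompR E (U x) (fderiv ℝ ρ (t • v - x))) μ :=
    (hρc.fderiv ℝ).convolutionExists_right _ hU (hρ.continuous_fderiv one_ne_zero) (t • v)
  have deriv := (hρc.hasFDerivAt_convolution_right L hU hρ (t • v)).comp_hasDerivAt t
    (by simpa using (hasDerivAt_id t).smul_const v : HasDerivAt (fun t : ℝ => t • v) v t)
  have deriv_eq : (convolution U (fderiv ℝ ρ) (L.precompR E) μ (t • v)) v =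
      - ∫ x, fderiv ℝ ψ (x - t • v) v • U x ∂μ := by
    rw [convolution_def, ContinuousLinearMap.integral_apply integrable, ← integral_neg]
    refine integral_congr_ae (Filter.Eventually.of_forall fun x => ?_)
    change fderiv ℝ ρ (t • v - x) v • U x = _
    rw [fderiv_ρ, neg_sub, neg_apply, neg_smul]
  rw [← deriv_eq]
  refine deriv.congr_of_eventuallyEq (Filter.Eventually.of_forall fun s => ?_)
  refine integral_congr_ae (Filter.Eventually.of_forall fun x => ?_)
  change _ = ψ (-(s • v - x)) • U x
  rw [neg_sub]

theorem integral_comp_sub_smul_indicator {E F : Type*} [AddCommGroup E] [TopologicalSpace E]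
    [IsTopologicalAddGroup E] [MeasurableSpace E] [BorelSpace E] {μ : Measure E}
    [μ.IsAddRightInvariant] [NormedAddCommGroup F] [NormedSpace ℝ F] {S Ω : Set E} {u : E → F}
    {ψ : E → ℝ} (hψS : Function.support ψ ⊆ S) {y : E} (hS : ∀ x ∈ S, x + y ∈ Ω) :
    ∫ x, ψ (x - y) • Ω.indicator u x ∂μ = ∫ x in S, ψ x • u (x + y) ∂μ := by
  rw [← integral_add_right_eq_self _ y,
    ← setIntegral_eq_integral_of_forall_compl_eq_zero (s := S)]
  · refine integral_congr_ae (Filter.Eventually.of_forall fun x => ?_)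
    by_cases hx : x ∈ Function.support ψ
    · simp [hS x (hψS hx)]
    · simp [Function.notMem_support.1 hx]
  · intro x hx
    simp [Function.notMem_support.1 fun h => hx (hψS h)]

theorem memLp_comp_add_right (hΩ : MeasurableSet Ω) (u : L2Dom Ω)
    {S : Set (EuclideanSpace ℝ (Fin d))} (hSm : MeasurableSet S) {y : EuclideanSpace ℝ (Fin d)}
    (hS : ∀ x ∈ S, x + y ∈ Ω) : MemLp (fun x => u (x + y)) 2 (volume.restrict S) := by
  have translated : MemLp (fun x => Ω.indicator u (x + y)) 2 volume :=
    ((memLp_indicator_iff_restrict hΩ).2 (Lp.memLp u)).comp_measurePreserving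
      (measurePreserving_add_right volume y)
  refine (translated.restrict S).ae_eq ?_
  filter_upwards [ae_restrict_mem hSm] with x hx
  exact Set.indicator_of_mem (hS x hx) _

/-- The pairing of `u` with the translates of `ψ` along the segment is differentiable, with
derivative a pairing of the weak gradient of `u`; apply the mean value inequality. -/
theorem IsWeakGradient.norm_integral_translate_le (hΩ : MeasurableSet Ω) {u : L2Dom Ω}
    {g : L2VecDom Ω} (h : IsWeakGradient u g) {S : Set (EuclideanSpace ℝ (Fin d))}
    (hSm : MeasurableSet S) {v : EuclideanSpace ℝ (Fin d)}
    (hS : ∀ x ∈ S, ∀ t ∈ Set.Icc (0 : ℝ) 1, x + t • v ∈ Ω)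
    {ψ : EuclideanSpace ℝ (Fin d) → ℝ} (hψ : ContDiff ℝ ∞ ψ) (hc : HasCompactSupport ψ)
    (hs : tsupport ψ ⊆ S) :
    ‖∫ x in S, ψ x • (u (x + v) - u x)‖ ≤ ‖v‖ * ‖g‖ * (eLpNorm ψ 2 volume).toReal := by
  set a : ℝ → ℂ := fun t => ∫ x, ψ (x - t • v) • Ω.indicator u x
  have hU : LocallyIntegrable (Ω.indicator u) volume :=
    ((memLp_indicator_iff_restrict hΩ).2 (Lp.memLp u)).locallyIntegrable (by norm_num)
  have a_eq (t : ℝ) (ht : t ∈ Set.Icc (0 : ℝ) 1) : a t = ∫ x in S, ψ x • u (x + t • v) :=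
    integral_comp_sub_smul_indicator ((subset_tsupport ψ).trans hs) fun x hx => hS x hx t ht
  have deriv_le (t : ℝ) (ht : t ∈ Set.Icc (0 : ℝ) 1) :
      ‖- ∫ x, fderiv ℝ ψ (x - t • v) v • Ω.indicator u x‖ ≤
        ‖v‖ * ‖g‖ * (eLpNorm ψ 2 volume).toReal := by
    have translate_support : tsupport (fun x => ψ (x - t • v)) ⊆ Ω := fun x hx => by
      simpa using hS _ (hs (tsupport_comp_subset_preimage ψ
        (Homeomorph.subRight (t • v)).continuous hx)) t ht
    have bound := h.norm_integral_fderiv_smul_le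
      (hψ.comp (contDiff_id.sub contDiff_const) : ContDiff ℝ ∞ fun x => ψ (x - t • v))
      (hc.comp_homeomorph (Homeomorph.subRight (t • v))) translate_support v
    rw [← eLpNorm_comp_measurePreserving hψ.continuous.aestronglyMeasurable
      (measurePreserving_sub_right volume (t • v)), norm_neg]
    refine le_of_eq_of_le (congrArg norm ?_) bound
    rw [← integral_indicator hΩ]
    refine integral_congr_ae (Filter.Eventually.of_forall fun x => ?_)
    by_cases hx : x ∈ Ω <;> simp [hx, Function.comp_def, fderiv_comp_sub]
  have mean_value : ‖a 1 - a 0‖ ≤ _ := norm_image_sub_le_of_norm_deriv_le_segment_01'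
    (fun t _ => (hasDerivAt_integral_comp_sub_smul hU (hψ.of_le (by simp)) hc v
      t).hasDerivWithinAt) (fun t ht => deriv_le t ⟨ht.1, ht.2.le⟩)
  have integrable (t : ℝ) (ht : t ∈ Set.Icc (0 : ℝ) 1) :
      Integrable (fun x => ψ x • u (x + t • v)) (volume.restrict S) :=
    integrable_smul_L2Dom hψ.continuous hc
      (memLp_comp_add_right hΩ u hSm fun x hx => hS x hx t ht)
  simp only [smul_sub]
  rw [integral_sub (by simpa using integrable 1 (by simp)) (by simpa using integrable 0 (by simp))]
  simpa only [a_eq 1 (by simp), a_eq 0 (by simp), one_smul, zero_smul, add_zero] using mean_value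

theorem IsWeakGradient.eLpNorm_translate_sub_le (hΩ : MeasurableSet Ω) {u : L2Dom Ω}
    {g : L2VecDom Ω} (h : IsWeakGradient u g) {S : Set (EuclideanSpace ℝ (Fin d))}
    (hSo : IsOpen S) {v : EuclideanSpace ℝ (Fin d)}
    (hS : ∀ x ∈ S, ∀ t ∈ Set.Icc (0 : ℝ) 1, x + t • v ∈ Ω) :
    eLpNorm (fun x => u (x + v) - u x) 2 (volume.restrict S) ≤ 2 * (‖v‖ₑ * ‖g‖ₑ) := by
  have hS0 : S ⊆ Ω := fun x hx => by simpa using hS x hx 0 (by simp)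
  have hS1 : ∀ x ∈ S, x + v ∈ Ω := fun x hx => by simpa using hS x hx 1 (by simp)
  have bound := eLpNorm_le_of_forall_test (M := ‖v‖₊ * ‖g‖₊) hSo
    ((memLp_comp_add_right hΩ u hSo.measurableSet hS1).sub
      ((Lp.memLp u).mono_measure (Measure.restrict_mono hS0 le_rfl))) fun ψ hψ hc hs => by
    rw [eLpNorm_restrict_eq_of_support_subset ((subset_tsupport ψ).trans hs)]
    exact h.norm_integral_translate_le hΩ hSo.measurableSet hS hψ hc hs
  rwa [ENNReal.coe_mul] at bound

end Translation

/-! ### Domains above Lipschitz graphs -/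

section Graph

variable {E : Type*} [NormedAddCommGroup E] [InnerProductSpace ℝ E] {e : E}
  {γ : ↥(Submodule.span ℝ {e})ᗮ → ℝ}

/-- The signed distance of `x`, in the vertical direction `e`, to the graph of `γ`. -/
noncomputable def heightAbove (e : E) (γ : ↥(Submodule.span ℝ {e})ᗮ → ℝ) (x : E) : ℝ :=
  inner ℝ e x - γ ((Submodule.span ℝ {e})ᗮ.orthogonalProjectionOnto x)

theorem orthogonalProjectionOnto_add_smul_self (e x : E) (t : ℝ) :
    (Submodule.span ℝ {e})ᗮ.orthogonalProjectionOnto (x + t • e) =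
      (Submodule.span ℝ {e})ᗮ.orthogonalProjectionOnto x := by
  have he : (Submodule.span ℝ {e})ᗮ.orthogonalProjectionOnto e = 0 := by
    rw [Submodule.orthogonalProjectionOnto_eq_zero_iff, Submodule.orthogonal_orthogonal]
    exact Submodule.mem_span_singleton_self e
  rw [map_add, map_smul, he, smul_zero, add_zero]

theorem heightAbove_add_smul_self (he : ‖e‖ = 1) (x : E) (t : ℝ) :
    heightAbove e γ (x + t • e) = heightAbove e γ x + t := by
  rw [heightAbove, heightAbove, orthogonalProjectionOnto_add_smul_self, inner_add_right,
    inner_smul_right, real_inner_self_eq_norm_sq, he]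
  ring

theorem continuous_heightAbove (hγ : Continuous γ) : Continuous (heightAbove e γ) :=
  (continuous_const.inner continuous_id).sub (hγ.comp (ContinuousLinearMap.continuous _))

theorem dist_add_smul_self_le (he : ‖e‖ = 1) (x p : E) {t : ℝ} (ht : 0 ≤ t) :
    dist (x + t • e) p ≤ dist x p + t := by
  refine (dist_triangle _ x _).trans_eq ?_
  rw [dist_self_add_left, norm_smul, he, mul_one, Real.norm_of_nonneg ht, add_comm]

/-- Inside the ball of radius `r` about `p`, the set `Ω` is the region strictly above the graph of
the `K`-Lipschitz function `γ`, the vertical direction being the unit vector `e`. -/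
structure IsGraphChart (Ω : Set E) (p e : E) (γ : ↥(Submodule.span ℝ {e})ᗮ → ℝ) (K : ℝ≥0)
    (r : ℝ) : Prop where
  norm_eq_one : ‖e‖ = 1
  lipschitzWith : LipschitzWith K γ
  pos : 0 < r
  mem_iff : ∀ x ∈ Metric.ball p r, x ∈ Ω ↔ 0 < heightAbove e γ x

namespace IsGraphChart

variable {Ω : Set E} {p x : E} {K : ℝ≥0} {r : ℝ}

theorem add_smul_mem (h : IsGraphChart Ω p e γ K r) {t : ℝ} (ht : 0 ≤ t)
    (hx : 0 < heightAbove e γ x + t) (hr : dist x p + t < r) : x + t • e ∈ Ω :=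
  (h.mem_iff _ ((dist_add_smul_self_le h.norm_eq_one x p ht).trans_lt hr)).2
    ((heightAbove_add_smul_self h.norm_eq_one x t).symm ▸ hx)

theorem mem_frontier_iff (h : IsGraphChart Ω p e γ K r) (hΩ : IsOpen Ω)
    (hx : x ∈ Metric.ball p r) : x ∈ frontier Ω ↔ heightAbove e γ x = 0 := by
  rw [hΩ.frontier_eq, Set.mem_sdiff, h.mem_iff x hx, not_lt]
  refine ⟨fun ⟨closure_mem, le_zero⟩ => le_antisymm le_zero ?_, fun height => ⟨?_, height.le⟩⟩
  · exact closure_minimal (fun y hy => ((h.mem_iff y hy.2).1 hy.1).le)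
      (isClosed_le continuous_const (continuous_heightAbove h.lipschitzWith.continuous))
      (Metric.isOpen_ball.closure_inter ⟨closure_mem, hx⟩)
  · have shift_tendsto : Filter.Tendsto (fun t : ℝ => x + t • e) (𝓝[>] 0) (𝓝 x) := by
      refine Filter.Tendsto.mono_left ?_ nhdsWithin_le_nhds
      exact Continuous.tendsto' (by fun_prop) 0 x (by simp)
    refine mem_closure_of_tendsto shift_tendsto ?_
    filter_upwards [Ioo_mem_nhdsGT (sub_pos.2 hx)] with t ht
    exact h.add_smul_mem ht.1.le (by linarith [ht.1]) (by linarith [ht.2])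

end IsGraphChart

theorem IsBoundedLipschitzDomain.exists_isGraphChart {d : ℕ} {Ω : Set (EuclideanSpace ℝ (Fin d))}
    (hΩ : IsBoundedLipschitzDomain Ω) {p : EuclideanSpace ℝ (Fin d)} (hp : p ∈ frontier Ω) :
    ∃ e γ K r, IsGraphChart Ω p e γ K r := by
  obtain ⟨e, γ, K, r, he, hγ, hr, h⟩ := hΩ.exists_graph p hp
  exact ⟨e, γ, K, r, he, hγ, hr, fun x hx => (h x hx).trans sub_pos.symm⟩

end Graph

/-! ### The Poincaré–Wirtinger inequality -/

theorem eLpNorm_two_sq {α F : Type*} [MeasurableSpace α] [NormedAddCommGroup F] {μ : Measure α}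
    (f : α → F) : eLpNorm f 2 μ ^ 2 = ∫⁻ x, ‖f x‖ₑ ^ 2 ∂μ := by
  simpa using eLpNorm_nnreal_pow_eq_lintegral (f := f) (μ := μ) (p := 2) two_ne_zero

theorem eLpNorm_two_restrict_union_le {α F : Type*} [MeasurableSpace α] [NormedAddCommGroup F]
    {μ : Measure α} (f : α → F) (s t : Set α) :
    eLpNorm f 2 (μ.restrict (s ∪ t)) ≤ eLpNorm f 2 (μ.restrict s) + eLpNorm f 2 (μ.restrict t) := by
  rw [← ENNReal.pow_le_pow_left_iff two_ne_zero, add_sq', eLpNorm_two_sq, eLpNorm_two_sq,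
    eLpNorm_two_sq]
  exact (lintegral_union_le _ s t).trans le_self_add

theorem eLpNorm_comp_add_right_le {E F : Type*} [AddGroup E] [MeasurableSpace E]
    [MeasurableAdd E] {μ : Measure E} [μ.IsAddRightInvariant] [NormedAddCommGroup F] {f : E → F}
    (hf : AEStronglyMeasurable f μ) {v : E} {S S' : Set E} (hS : ∀ x ∈ S', x + v ∈ S) (p : ℝ≥0∞) :
    eLpNorm (fun x => f (x + v)) p (μ.restrict S') ≤ eLpNorm f p (μ.restrict S) :=
  (eLpNorm_mono_measure _ (Measure.restrict_mono hS le_rfl)).trans_eq <|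
    eLpNorm_comp_measurePreserving hf.restrict <|
      (measurePreserving_add_right μ v).restrict_preimage_emb (measurableEmbedding_addRight v) S

section Propagation

variable {d : ℕ} {Ω B S S' : Set (EuclideanSpace ℝ (Fin d))}

/-- The `L^2` norm on `S` of functions in `H^1(Ω)` is controlled by the gradient and the `L^2` norm
on `B`. -/
def IsControlled (Ω B S : Set (EuclideanSpace ℝ (Fin d))) : Prop :=
  ∃ C : ℝ≥0, ∀ w : H1 Ω, eLpNorm (H1.toFun w) 2 (volume.restrict S) ≤
    C * (‖H1.grad w‖ₑ + eLpNorm (H1.toFun w) 2 (volume.restrict B))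

namespace IsControlled

theorem mono (h : IsControlled Ω B S) (hS : S' ⊆ S) : IsControlled Ω B S' :=
  h.imp fun _ hC w => (eLpNorm_mono_measure _ (Measure.restrict_mono hS le_rfl)).trans (hC w)

theorem self : IsControlled Ω B B := ⟨1, fun w => by simp⟩

theorem empty : IsControlled Ω B ∅ := ⟨1, fun w => by simp⟩

theorem union (h : IsControlled Ω B S) (h' : IsControlled Ω B S') :
    IsControlled Ω B (S ∪ S') := by
  obtain ⟨C, hC⟩ := h
  obtain ⟨C', hC'⟩ := h'
  refine ⟨C + C', fun w => (eLpNorm_two_restrict_union_le _ S S').trans ?_⟩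
  rw [ENNReal.coe_add, add_mul]
  exact add_le_add (hC w) (hC' w)

theorem of_translate (hΩ : MeasurableSet Ω) (h : IsControlled Ω B S)
    {v : EuclideanSpace ℝ (Fin d)} (hS'o : IsOpen S') (hS' : ∀ x ∈ S', x + v ∈ S)
    (segment_mem : ∀ x ∈ S', ∀ t ∈ Set.Icc (0 : ℝ) 1, x + t • v ∈ Ω) :
    IsControlled Ω B S' := by
  obtain ⟨C, hC⟩ := h
  refine ⟨2 * ‖v‖₊ + C, fun w => ?_⟩
  let u : EuclideanSpace ℝ (Fin d) → ℂ := H1.toFun w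
  have hu : StronglyMeasurable u := Lp.stronglyMeasurable _
  have huv : StronglyMeasurable fun x => u (x + v) := hu.comp_measurable (measurable_add_const v)
  have triangle : eLpNorm u 2 (volume.restrict S') ≤
      eLpNorm (fun x => u (x + v)) 2 (volume.restrict S') +
        eLpNorm (fun x => u (x + v) - u x) 2 (volume.restrict S') := by
    have sub_le := eLpNorm_sub_le (p := 2) (μ := volume.restrict S') huv.aestronglyMeasurable
      (huv.sub hu).aestronglyMeasurable (by norm_num)
    rwa [sub_sub_cancel] at sub_le
  have translate_sub : eLpNorm (fun x => u (x + v) - u x) 2 (volume.restrict S') ≤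
      2 * (‖v‖ₑ * ‖H1.grad w‖ₑ) :=
    IsWeakGradient.eLpNorm_translate_sub_le (u := H1.toFun w) (g := H1.grad w) hΩ w.2 hS'o
      segment_mem
  calc eLpNorm u 2 (volume.restrict S')
      ≤ C * (‖H1.grad w‖ₑ + eLpNorm u 2 (volume.restrict B)) + 2 * (‖v‖ₑ * ‖H1.grad w‖ₑ) :=
        triangle.trans (add_le_add
          ((eLpNorm_comp_add_right_le hu.aestronglyMeasurable hS' 2).trans (hC w)) translate_sub)
    _ ≤ C * (‖H1.grad w‖ₑ + eLpNorm u 2 (volume.restrict B)) +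
          2 * (‖v‖ₑ * (‖H1.grad w‖ₑ + eLpNorm u 2 (volume.restrict B))) := by
        gcongr
        exact le_self_add
    _ = _ := by
        push_cast
        rw [enorm_eq_nnnorm v]
        ring

theorem exists_ball (hΩ : IsOpen Ω) (hΩc : IsPreconnected Ω) {x₀ x : EuclideanSpace ℝ (Fin d)}
    {r₀ : ℝ} (hr₀ : 0 < r₀) (hx₀ : x₀ ∈ Ω) (hx : x ∈ Ω) :
    ∃ r > 0, IsControlled Ω (Metric.ball x₀ r₀) (Metric.ball x r) := by
  let G := {x | ∃ r > 0, IsControlled Ω (Metric.ball x₀ r₀) (Metric.ball x r)}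
  have isOpen_G : IsOpen G := by
    refine Metric.isOpen_iff.2 fun y ⟨r, hr, h⟩ => ⟨r / 2, by positivity, fun z hz =>
      ⟨r / 2, by positivity, h.mono (Metric.ball_subset_ball' ?_)⟩⟩
    linarith [Metric.mem_ball.1 hz]
  refine hΩc.subset_of_closure_inter_subset (u := G) isOpen_G ⟨x₀, hx₀, r₀, hr₀, self⟩ ?_ hx
  rintro y ⟨hy, hyΩ⟩
  obtain ⟨r, hr, ball_subset⟩ := Metric.isOpen_iff.1 hΩ y hyΩ
  obtain ⟨z, ⟨s, hs, controlled_z⟩, hzy⟩ := Metric.mem_closure_iff.1 hy (r / 2) (by positivity)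
  have dist_translate (a : EuclideanSpace ℝ (Fin d)) : dist (a + (z - y)) z = dist a y := by
    rw [dist_eq_norm, dist_eq_norm, add_sub_assoc, sub_sub_cancel_left, ← sub_eq_add_neg]
  refine ⟨min s (r / 2), by positivity, controlled_z.of_translate hΩ.measurableSet (v := z - y)
    Metric.isOpen_ball (fun a ha => ?_) fun a ha t ht => ball_subset ?_⟩
  · rw [Metric.mem_ball, dist_translate]
    exact ha.trans_le (min_le_left _ _)
  · have ha' : dist a y < r / 2 := ha.trans_le (min_le_right _ _)
    refine (convex_ball y r).add_smul_mem (Metric.mem_ball.2 (by linarith)) ?_ ht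
    have := dist_triangle (a + (z - y)) z y
    rw [dist_translate, dist_comm z y] at this
    exact this.trans_lt (by linarith)

/-- Near the boundary, translating upwards in a graph chart leads into the interior. -/
theorem exists_ball_inter (hΩ : IsBoundedLipschitzDomain Ω) {x₀ p : EuclideanSpace ℝ (Fin d)}
    {r₀ : ℝ} (hr₀ : 0 < r₀) (hx₀ : x₀ ∈ Ω) (hp : p ∈ frontier Ω) :
    ∃ s > 0, IsControlled Ω (Metric.ball x₀ r₀) (Metric.ball p s ∩ Ω) := by
  obtain ⟨e, γ, K, r, chart⟩ := hΩ.exists_isGraphChart hp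
  have hr := chart.pos
  have height_p := (chart.mem_frontier_iff hΩ.isOpen (Metric.mem_ball_self hr)).1 hp
  have interior_point : p + (r / 2) • e ∈ Ω :=
    chart.add_smul_mem (by positivity) (by linarith) (by rw [dist_self]; linarith)
  obtain ⟨s, hs, controlled⟩ := exists_ball hΩ.isOpen hΩ.isConnected.isPreconnected hr₀ hx₀
    interior_point
  refine ⟨min s (r / 4), by positivity, controlled.of_translate hΩ.isOpen.measurableSet
    (v := (r / 2) • e) (Metric.isOpen_ball.inter hΩ.isOpen) (fun x hx => ?_) fun x hx t ht => ?_⟩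
  · rw [Metric.mem_ball, dist_add_right]
    exact hx.1.trans_le (min_le_left _ _)
  · have hxp : dist x p < r / 4 := hx.1.trans_le (min_le_right _ _)
    have height_x := (chart.mem_iff x (Metric.mem_ball.2 (by linarith))).1 hx.2
    have shift_nonneg : 0 ≤ t * (r / 2) := mul_nonneg ht.1 (by positivity)
    have shift_le : t * (r / 2) ≤ r / 2 := mul_le_of_le_one_left (by positivity) ht.2
    rw [smul_smul]
    exact chart.add_smul_mem shift_nonneg (by linarith) (by linarith)

theorem domain (hΩ : IsBoundedLipschitzDomain Ω) {x₀ : EuclideanSpace ℝ (Fin d)} {r₀ : ℝ}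
    (hr₀ : 0 < r₀) (hx₀ : x₀ ∈ Ω) : IsControlled Ω (Metric.ball x₀ r₀) Ω := by
  suffices IsControlled Ω (Metric.ball x₀ r₀) (closure Ω ∩ Ω) from
    this.mono (Set.subset_inter subset_closure subset_rfl)
  refine hΩ.isBounded.isCompact_closure.induction_on
    (p := fun t => IsControlled Ω (Metric.ball x₀ r₀) (t ∩ Ω)) ?_ ?_ ?_ fun x hx => ?_
  · exact (Set.empty_inter Ω).symm ▸ empty
  · exact fun s t hst h => h.mono (Set.inter_subset_inter_left Ω hst)
  · exact fun s t h h' => Set.union_inter_distrib_right s t Ω ▸ h.union h'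
  · obtain ⟨r, hr, h⟩ : ∃ r > 0, IsControlled Ω (Metric.ball x₀ r₀) (Metric.ball x r ∩ Ω) := by
      by_cases hxΩ : x ∈ Ω
      · obtain ⟨r, hr, h⟩ := exists_ball hΩ.isOpen hΩ.isConnected.isPreconnected hr₀ hx₀ hxΩ
        exact ⟨r, hr, h.mono Set.inter_subset_left⟩
      · exact exists_ball_inter hΩ hr₀ hx₀ (hΩ.isOpen.frontier_eq ▸ ⟨hx, hxΩ⟩)
    exact ⟨_, mem_nhdsWithin_of_mem_nhds (Metric.ball_mem_nhds x hr), h⟩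

end IsControlled

end Propagation

theorem setLIntegral_setLIntegral_eq_lintegral_translate {G : Type*} [AddGroup G]
    [MeasurableSpace G] [MeasurableAdd₂ G] {μ : Measure G} [SFinite μ] [μ.IsAddLeftInvariant]
    {B : Set G} (hB : MeasurableSet B) {F : G → G → ℝ≥0∞} (hF : Measurable (Function.uncurry F)) :
    ∫⁻ x in B, ∫⁻ y in B, F x y ∂μ ∂μ =
      ∫⁻ v, ∫⁻ x in B ∩ (fun x => x + v) ⁻¹' B, F x (x + v) ∂μ ∂μ := by
  let T : Set (G × G) := Prod.fst ⁻¹' B ∩ (fun z => z.1 + z.2) ⁻¹' B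
  let H : G × G → ℝ≥0∞ := T.indicator fun z => F z.1 (z.1 + z.2)
  have hT : MeasurableSet T := (measurable_fst hB).inter ((measurable_fst.add measurable_snd) hB)
  have hH : Measurable H :=
    (hF.comp (measurable_fst.prodMk (measurable_fst.add measurable_snd))).indicator hT
  have inner_left (x : G) : B.indicator (fun x => ∫⁻ y in B, F x y ∂μ) x = ∫⁻ v, H (x, v) ∂μ := by
    by_cases hx : x ∈ B
    · rw [Set.indicator_of_mem hx, ← lintegral_indicator hB, ← lintegral_add_left_eq_self _ x]
      refine lintegral_congr fun v => ?_
      by_cases hv : x + v ∈ B <;> simp [H, T, hx, hv]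
    · simp [H, T, hx]
  have inner_right (v : G) :
      ∫⁻ x in B ∩ (fun x => x + v) ⁻¹' B, F x (x + v) ∂μ = ∫⁻ x, H (x, v) ∂μ := by
    rw [← lintegral_indicator (hB.inter ((measurable_add_const v) hB))]
    rfl
  rw [← lintegral_indicator hB]
  simp only [inner_left, inner_right]
  exact lintegral_lintegral_swap hH.aemeasurable

theorem exists_eLpNorm_sub_sq_le_laverage {α F : Type*} [MeasurableSpace α] {μ : Measure α}
    [IsFiniteMeasure μ] [NormedAddCommGroup F] {f : α → F} (hμ : μ ≠ 0)
    (hf : StronglyMeasurable f) :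
    ∃ x, eLpNorm (fun y => f y - f x) 2 μ ^ 2 ≤ ⨍⁻ x, ∫⁻ y, ‖f y - f x‖ₑ ^ 2 ∂μ ∂μ := by
  have measurable : Measurable fun x => ∫⁻ y, ‖f y - f x‖ₑ ^ 2 ∂μ :=
    Measurable.lintegral_prod_right' (f := fun z : α × α => ‖f z.2 - f z.1‖ₑ ^ 2)
      (((hf.comp_measurable measurable_snd).sub
        (hf.comp_measurable measurable_fst)).enorm.pow_const 2)
  obtain ⟨x, hx⟩ := exists_le_laverage hμ measurable.aemeasurable
  exact ⟨x, (eLpNorm_two_sq _).trans_le hx⟩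

section Convex

variable {d : ℕ} {Ω B : Set (EuclideanSpace ℝ (Fin d))}

theorem IsWeakGradient.setLIntegral_setLIntegral_sub_sq_le (hΩ : MeasurableSet Ω) {u : L2Dom Ω}
    {g : L2VecDom Ω} (h : IsWeakGradient u g) (hBo : IsOpen B) (hBc : Convex ℝ B)
    (hBb : Bornology.IsBounded B) (hBΩ : B ⊆ Ω) :
    ∫⁻ x in B, ∫⁻ y in B, ‖u y - u x‖ₑ ^ 2 ≤
      volume (Metric.closedBall (0 : EuclideanSpace ℝ (Fin d)) (Metric.diam B)) *
        (2 * (ENNReal.ofReal (Metric.diam B) * ‖g‖ₑ)) ^ 2 := by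
  set V := Metric.closedBall (0 : EuclideanSpace ℝ (Fin d)) (Metric.diam B)
  have hu : StronglyMeasurable u := Lp.stronglyMeasurable u
  have measurable : Measurable (Function.uncurry fun x y => ‖u y - u x‖ₑ ^ 2) :=
    ((hu.comp_measurable measurable_snd).sub (hu.comp_measurable measurable_fst)).enorm.pow_const 2
  have translate_le (v : EuclideanSpace ℝ (Fin d)) :
      ∫⁻ x in B ∩ (fun x => x + v) ⁻¹' B, ‖u (x + v) - u x‖ₑ ^ 2 ≤
        V.indicator (fun _ => (2 * (ENNReal.ofReal (Metric.diam B) * ‖g‖ₑ)) ^ 2) v := by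
    rcases (B ∩ (fun x => x + v) ⁻¹' B).eq_empty_or_nonempty with overlap | ⟨x, hx, hxv⟩
    · rw [overlap, Measure.restrict_empty, lintegral_zero_measure]
      exact zero_le
    · have norm_v : ‖v‖ ≤ Metric.diam B := by
        simpa using Metric.dist_le_diam_of_mem hBb hxv hx
      rw [Set.indicator_of_mem (mem_closedBall_zero_iff.2 norm_v), ← eLpNorm_two_sq]
      have bound := h.eLpNorm_translate_sub_le hΩ (v := v)
        (hBo.inter (hBo.preimage (continuous_add_const v)))
        fun x hx t ht => hBΩ (hBc.add_smul_mem hx.1 hx.2 ht)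
      rw [← ofReal_norm v] at bound
      exact pow_le_pow_left' (bound.trans (by gcongr)) 2
  rw [setLIntegral_setLIntegral_eq_lintegral_translate hBo.measurableSet measurable]
  refine (lintegral_mono translate_le).trans_eq ?_
  rw [lintegral_indicator_const Metric.isClosed_closedBall.measurableSet, mul_comm]

theorem exists_const_eLpNorm_sub_le_of_convex (hΩ : MeasurableSet Ω) (hBo : IsOpen B)
    (hBc : Convex ℝ B) (hBb : Bornology.IsBounded B) (hBne : B.Nonempty) (hBΩ : B ⊆ Ω) :
    ∃ C : ℝ≥0, ∀ w : H1 Ω, ∃ c : ℂ,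
      eLpNorm (fun x => H1.toFun w x - c) 2 (volume.restrict B) ≤ C * ‖H1.grad w‖ₑ := by
  have : IsFiniteMeasure (volume.restrict B) := isFiniteMeasure_restrict.2 hBb.measure_lt_top.ne
  have volume_ne_zero : volume B ≠ 0 := (hBo.measure_pos volume hBne).ne'
  set V := Metric.closedBall (0 : EuclideanSpace ℝ (Fin d)) (Metric.diam B)
  set M : ℝ≥0∞ := (volume B)⁻¹ * (volume V * (2 * ENNReal.ofReal (Metric.diam B)) ^ 2) with hM
  have M_ne_top : M ≠ ⊤ := ENNReal.mul_ne_top (ENNReal.inv_ne_top.2 volume_ne_zero)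
    (ENNReal.mul_ne_top measure_closedBall_lt_top.ne (by finiteness))
  refine ⟨NNReal.sqrt M.toNNReal, fun w => ?_⟩
  obtain ⟨x, hx⟩ := exists_eLpNorm_sub_sq_le_laverage (μ := volume.restrict B)
    (by simpa using volume_ne_zero) (Lp.stronglyMeasurable (H1.toFun w))
  refine ⟨H1.toFun w x, (ENNReal.pow_le_pow_left_iff two_ne_zero).1 (hx.trans ?_)⟩
  rw [setLAverage_eq, ENNReal.div_eq_inv_mul]
  calc (volume B)⁻¹ * ∫⁻ x in B, ∫⁻ y in B, ‖H1.toFun w y - H1.toFun w x‖ₑ ^ 2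
      ≤ (volume B)⁻¹ * (volume V * (2 * (ENNReal.ofReal (Metric.diam B) * ‖H1.grad w‖ₑ)) ^ 2) :=
        mul_le_mul_right (IsWeakGradient.setLIntegral_setLIntegral_sub_sq_le (u := H1.toFun w)
          (g := H1.grad w) hΩ w.2 hBo hBc hBb hBΩ) _
    _ = M * ‖H1.grad w‖ₑ ^ 2 := by rw [hM]; ring
    _ = _ := by rw [mul_pow, ← ENNReal.coe_pow, NNReal.sq_sqrt, ENNReal.coe_toNNReal M_ne_top]

end Convex

/-! ### Surface measure of Lipschitz graphs -/

theorem euclideanHausdorffMeasure_image_le {X Y : Type*} [EMetricSpace X]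
    [MeasurableSpace X] [BorelSpace X] [EMetricSpace Y] [MeasurableSpace Y] [BorelSpace Y]
    {K : ℝ≥0} {f : X → Y} (hf : LipschitzWith K f) (n : ℕ) (s : Set X) :
    Measure.euclideanHausdorffMeasure n (f '' s) ≤
      (K : ℝ≥0∞) ^ n * Measure.euclideanHausdorffMeasure n s := by
  rw [Measure.euclideanHausdorffMeasure_def, Measure.euclideanHausdorffMeasure_def,
    Measure.smul_apply, Measure.smul_apply, ENNReal.smul_def, ENNReal.smul_def, smul_eq_mul,
    smul_eq_mul, mul_left_comm]
  gcongr
  simpa using hf.hausdorffMeasure_image_le (d := n) (by positivity) s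

section GraphMap

variable {E : Type*} [NormedAddCommGroup E] [InnerProductSpace ℝ E] {e : E}
  {γ : ↥(Submodule.span ℝ {e})ᗮ → ℝ}

/-- The parametrisation of the graph of `γ` over the hyperplane orthogonal to `e`. -/
noncomputable def graphMap (e : E) (γ : ↥(Submodule.span ℝ {e})ᗮ → ℝ)
    (y : ↥(Submodule.span ℝ {e})ᗮ) : E := y + γ y • e

theorem lipschitzWith_graphMap (he : ‖e‖ = 1) {K : ℝ≥0} (hγ : LipschitzWith K γ) :
    LipschitzWith (1 + K) (graphMap e γ) := by
  refine LipschitzWith.add (LipschitzWith.subtype_val _)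
    (LipschitzWith.of_dist_le_mul fun x y => ?_)
  rw [dist_eq_norm, ← sub_smul, norm_smul, he, mul_one, ← dist_eq_norm]
  exact hγ.dist_le_mul x y

theorem orthogonalProjectionOnto_graphMap (γ : ↥(Submodule.span ℝ {e})ᗮ → ℝ)
    (y : ↥(Submodule.span ℝ {e})ᗮ) :
    (Submodule.span ℝ {e})ᗮ.orthogonalProjectionOnto (graphMap e γ y) = y := by
  rw [graphMap, orthogonalProjectionOnto_add_smul_self,
    Submodule.orthogonalProjectionOnto_mem_subspace_eq_self]

theorem heightAbove_graphMap (he : ‖e‖ = 1) (y : ↥(Submodule.span ℝ {e})ᗮ) :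
    heightAbove e γ (graphMap e γ y) = 0 := by
  rw [graphMap, heightAbove_add_smul_self he, heightAbove,
    Submodule.mem_orthogonal_singleton_iff_inner_right.1 y.2,
    Submodule.orthogonalProjectionOnto_mem_subspace_eq_self]
  ring

theorem graphMap_orthogonalProjectionOnto (he : ‖e‖ = 1) {x : E} (hx : heightAbove e γ x = 0) :
    graphMap e γ ((Submodule.span ℝ {e})ᗮ.orthogonalProjectionOnto x) = x := by
  have split := Submodule.starProjection_add_starProjection_orthogonal
    (K := Submodule.span ℝ {e}) x
  rw [Submodule.starProjection_unit_singleton ℝ he, Submodule.starProjection_apply, add_comm]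
    at split
  rwa [graphMap, ← sub_eq_zero.1 hx]

theorem preimage_graphMap_ball_subset (p : E) (r : ℝ) :
    graphMap e γ ⁻¹' Metric.ball p r ⊆
      Metric.ball ((Submodule.span ℝ {e})ᗮ.orthogonalProjectionOnto p) r := by
  intro y hy
  have dist_le := (Submodule.span ℝ {e})ᗮ.lipschitzWith_orthogonalProjectionOnto.dist_le_mul
    (graphMap e γ y) p
  rw [orthogonalProjectionOnto_graphMap, NNReal.coe_one, one_mul] at dist_le
  exact dist_le.trans_lt hy

end GraphMap

section Surface

variable {d : ℕ} {e : EuclideanSpace ℝ (Fin d)} {γ : ↥(Submodule.span ℝ {e})ᗮ → ℝ}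

theorem euclideanHausdorffMeasure_hyperplane (he : ‖e‖ = 1) :
    (Measure.euclideanHausdorffMeasure (d - 1) : Measure ↥(Submodule.span ℝ {e})ᗮ) = volume := by
  have finrank_eq : Module.finrank ℝ ↥(Submodule.span ℝ {e})ᗮ = d - 1 := by
    have add_finrank := Submodule.finrank_add_finrank_orthogonal (Submodule.span ℝ {e})
    rw [finrank_span_singleton (norm_ne_zero_iff.1 (he ▸ one_ne_zero)),
      finrank_euclideanSpace_fin] at add_finrank
    omega
  rw [← finrank_eq]
  exact InnerProductSpace.euclideanHausdorffMeasure_eq_volume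

theorem euclideanHausdorffMeasure_le_volume_preimage_graphMap (he : ‖e‖ = 1) {K : ℝ≥0}
    (hγ : LipschitzWith K γ) {S : Set (EuclideanSpace ℝ (Fin d))}
    (hS : ∀ x ∈ S, heightAbove e γ x = 0) :
    Measure.euclideanHausdorffMeasure (d - 1) S ≤
      ((1 + K : ℝ≥0) : ℝ≥0∞) ^ (d - 1) * volume (graphMap e γ ⁻¹' S) := by
  have image_le := euclideanHausdorffMeasure_image_le (lipschitzWith_graphMap he hγ) (d - 1)
    (graphMap e γ ⁻¹' S)
  rw [euclideanHausdorffMeasure_hyperplane he] at image_le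
  refine (measure_mono fun x hx => ?_).trans image_le
  have graphMap_eq := graphMap_orthogonalProjectionOnto he (hS x hx)
  exact ⟨_, by rwa [Set.mem_preimage, graphMap_eq], graphMap_eq⟩

variable {Ω Γ : Set (EuclideanSpace ℝ (Fin d))}

theorem IsBoundedLipschitzDomain.isCompact_frontier (hΩ : IsBoundedLipschitzDomain Ω) :
    IsCompact (frontier Ω) :=
  hΩ.isBounded.isCompact_closure.of_isClosed_subset isClosed_frontier frontier_subset_closure

theorem isFiniteMeasure_surfaceMeasure (hΩ : IsBoundedLipschitzDomain Ω)
    (hΓ : Γ ⊆ frontier Ω) : IsFiniteMeasure (surfaceMeasure Γ) := by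
  refine isFiniteMeasure_restrict.2 (ne_top_of_le_ne_top (LT.lt.ne ?_) (measure_mono hΓ))
  refine hΩ.isCompact_frontier.measure_lt_top_of_nhdsWithin fun p hp => ?_
  obtain ⟨e, γ, K, r, chart⟩ := hΩ.exists_isGraphChart hp
  refine ⟨frontier Ω ∩ Metric.ball p r,
    inter_mem_nhdsWithin _ (Metric.ball_mem_nhds p chart.pos), ?_⟩
  refine (euclideanHausdorffMeasure_le_volume_preimage_graphMap chart.norm_eq_one
    chart.lipschitzWith fun x hx => (chart.mem_frontier_iff hΩ.isOpen hx.2).1 hx.1).trans_lt ?_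
  exact ENNReal.mul_lt_top (by finiteness) ((measure_mono ((Set.preimage_mono
    Set.inter_subset_right).trans (preimage_graphMap_ball_subset p r))).trans_lt
      measure_ball_lt_top)

/-- The orthogonal projection onto the base of a chart is nonexpansive, and it maps `Γ` onto a set
with interior points. -/
theorem surfaceMeasure_ne_zero (hΩ : IsBoundedLipschitzDomain Ω)
    (hΓ : IsRelOpenBoundary Ω Γ) (hΓne : Γ.Nonempty) : surfaceMeasure Γ ≠ 0 := by
  intro surface_null
  rw [surfaceMeasure, Measure.restrict_eq_zero] at surface_null
  obtain ⟨U, hU, rfl⟩ := hΓ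
  obtain ⟨p, hpU, hp⟩ := hΓne
  obtain ⟨e, γ, K, r, chart⟩ := hΩ.exists_isGraphChart hp
  have he := chart.norm_eq_one
  have projection_null := euclideanHausdorffMeasure_image_le
    (Submodule.span ℝ {e})ᗮ.lipschitzWith_orthogonalProjectionOnto (d - 1) (U ∩ frontier Ω)
  rw [surface_null, mul_zero, nonpos_iff_eq_zero, euclideanHausdorffMeasure_hyperplane he]
    at projection_null
  have isOpen_preimage : IsOpen (graphMap e γ ⁻¹' (U ∩ Metric.ball p r)) :=
    (hU.inter Metric.isOpen_ball).preimage
      (lipschitzWith_graphMap he chart.lipschitzWith).continuous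
  have preimage_nonempty : (graphMap e γ ⁻¹' (U ∩ Metric.ball p r)).Nonempty := by
    refine ⟨(Submodule.span ℝ {e})ᗮ.orthogonalProjectionOnto p, ?_⟩
    rw [Set.mem_preimage, graphMap_orthogonalProjectionOnto he
      ((chart.mem_frontier_iff hΩ.isOpen (Metric.mem_ball_self chart.pos)).1 hp)]
    exact ⟨hpU, Metric.mem_ball_self chart.pos⟩
  refine (isOpen_preimage.measure_pos volume preimage_nonempty).ne'
    (measure_mono_null (fun y hy => ?_) projection_null)
  exact ⟨graphMap e γ y, ⟨hy.1, (chart.mem_frontier_iff hΩ.isOpen hy.2).2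
    (heightAbove_graphMap he y)⟩, orthogonalProjectionOnto_graphMap γ y⟩

end Surface

/-! ### The trace inequality -/

section Segment

variable {F : Type*} [NormedAddCommGroup F] [InnerProductSpace ℝ F] {q q' : ℝ → F} {δ : ℝ}

theorem norm_sq_le_intervalIntegral (hq : ∀ t, HasDerivAt q (q' t) t) (hq' : Continuous q')
    (hδ : 0 < δ) :
    ‖q 0‖ ^ 2 ≤ ∫ t in 0..δ, (δ⁻¹ + 1) * (‖q t‖ ^ 2 + ‖q' t‖ ^ 2) := by
  -- Integrate the derivative of `(1 - t / δ) ‖q t‖²`, which vanishes at `t = δ`.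
  let w' (t : ℝ) : ℝ := -δ⁻¹ * ‖q t‖ ^ 2 + (1 - δ⁻¹ * t) * (2 * inner ℝ (q t) (q' t))
  have hasDerivAt_weighted (t : ℝ) :
      HasDerivAt (fun t => (1 - δ⁻¹ * t) * ‖q t‖ ^ 2) (w' t) t := by
    have product := (((hasDerivAt_id t).const_mul δ⁻¹).const_sub 1).mul (hq t).norm_sq
    exact product.congr_deriv (by simp [w'])
  have hqc : Continuous q := continuous_iff_continuousAt.2 fun t => (hq t).continuousAt
  have continuous_w' : Continuous w' := by fun_prop
  have fundamental := intervalIntegral.integral_eq_sub_of_hasDerivAt (a := 0) (b := δ)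
    (fun t _ => hasDerivAt_weighted t) (continuous_w'.intervalIntegrable 0 δ)
  have norm_sq_eq : ‖q 0‖ ^ 2 = ∫ t in 0..δ, -w' t := by
    rw [intervalIntegral.integral_neg, fundamental, inv_mul_cancel₀ hδ.ne']
    simp
  rw [norm_sq_eq]
  refine intervalIntegral.integral_mono_on hδ.le (continuous_w'.neg.intervalIntegrable 0 δ)
    (Continuous.intervalIntegrable (by fun_prop) 0 δ) fun t ht => ?_
  have inner_le : -(2 * inner ℝ (q t) (q' t)) ≤ ‖q t‖ ^ 2 + ‖q' t‖ ^ 2 := by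
    nlinarith [neg_abs_le (inner ℝ (q t) (q' t)), abs_real_inner_le_norm (q t) (q' t),
      sq_nonneg (‖q t‖ - ‖q' t‖)]
  have weight_nonneg : 0 ≤ 1 - δ⁻¹ * t := by
    rw [sub_nonneg, inv_mul_le_iff₀ hδ, mul_one]
    exact ht.2
  have weight_le_one : 1 - δ⁻¹ * t ≤ 1 := by
    have := mul_nonneg (inv_nonneg.2 hδ.le) ht.1
    linarith
  calc -w' t = δ⁻¹ * ‖q t‖ ^ 2 + (1 - δ⁻¹ * t) * -(2 * inner ℝ (q t) (q' t)) := by ring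
    _ ≤ δ⁻¹ * (‖q t‖ ^ 2 + ‖q' t‖ ^ 2) + 1 * (‖q t‖ ^ 2 + ‖q' t‖ ^ 2) := by
        refine add_le_add ?_ ((mul_le_mul_of_nonneg_left inner_le weight_nonneg).trans
          (mul_le_mul_of_nonneg_right weight_le_one (by positivity)))
        gcongr
        exact le_add_of_nonneg_right (sq_nonneg _)
    _ = (δ⁻¹ + 1) * (‖q t‖ ^ 2 + ‖q' t‖ ^ 2) := by ring

theorem enorm_sq_le_setLIntegral (hq : ∀ t, HasDerivAt q (q' t) t) (hq' : Continuous q')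
    (hδ : 0 < δ) :
    ‖q 0‖ₑ ^ 2 ≤
      ENNReal.ofReal (δ⁻¹ + 1) * ∫⁻ t in Set.Ioc 0 δ, (‖q t‖ₑ ^ 2 + ‖q' t‖ₑ ^ 2) := by
  have hqc : Continuous q := continuous_iff_continuousAt.2 fun t => (hq t).continuousAt
  have real_bound := ENNReal.ofReal_le_ofReal (norm_sq_le_intervalIntegral hq hq' hδ)
  have integrable : IntegrableOn (fun t => ‖q t‖ ^ 2 + ‖q' t‖ ^ 2) (Set.Ioc 0 δ) :=
    (Continuous.integrableOn_Icc (by fun_prop)).mono_set Set.Ioc_subset_Icc_self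
  rw [intervalIntegral.integral_of_le hδ.le, integral_const_mul,
    ENNReal.ofReal_mul (by positivity), ofReal_integral_eq_lintegral_ofReal integrable
      (Filter.Eventually.of_forall fun t => by positivity)] at real_bound
  have ofReal_norm_sq (x : F) : ENNReal.ofReal (‖x‖ ^ 2) = ‖x‖ₑ ^ 2 := by
    rw [ENNReal.ofReal_pow (norm_nonneg _), ofReal_norm]
  simpa only [ENNReal.ofReal_add (sq_nonneg _) (sq_nonneg _), ofReal_norm_sq] using real_bound

end Segment

section EnergyDensity

variable {E F : Type*} [NormedAddCommGroup E] [NormedSpace ℝ E] [NormedAddCommGroup F]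

/-- The density `|φ|² + |∇φ|²` of the squared `H¹` norm of a classically differentiable `φ`. -/
noncomputable def energyDensity [NormedSpace ℝ F] (φ : E → F) (x : E) : ℝ≥0∞ :=
  ‖φ x‖ₑ ^ 2 + ‖fderiv ℝ φ x‖ₑ ^ 2

theorem measurable_energyDensity [NormedSpace ℝ F] [MeasurableSpace E] [BorelSpace E] {φ : E → F}
    (hφ : ContDiff ℝ 1 φ) : Measurable (energyDensity φ) :=
  (hφ.continuous.enorm.measurable.pow_const 2).add
    ((hφ.continuous_fderiv one_ne_zero).enorm.measurable.pow_const 2)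

theorem enorm_sq_le_setLIntegral_energyDensity [InnerProductSpace ℝ F] {φ : E → F}
    (hφ : ContDiff ℝ 1 φ) {e : E} (he : ‖e‖ = 1) {δ : ℝ} (hδ : 0 < δ) (x : E) :
    ‖φ x‖ₑ ^ 2 ≤
      ENNReal.ofReal (δ⁻¹ + 1) * ∫⁻ t in Set.Ioc 0 δ, energyDensity φ (x + t • e) := by
  have hasDerivAt_line (t : ℝ) :
      HasDerivAt (fun t : ℝ => φ (x + t • e)) (fderiv ℝ φ (x + t • e) e) t :=
    (hφ.differentiable one_ne_zero).differentiableAt.hasFDerivAt.comp_hasDerivAt t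
      (by simpa using ((hasDerivAt_id t).smul_const e).const_add x)
  have continuous_deriv : Continuous fun t : ℝ => fderiv ℝ φ (x + t • e) e :=
    ((hφ.continuous_fderiv one_ne_zero).comp (by fun_prop)).clm_apply continuous_const
  have segment_bound := enorm_sq_le_setLIntegral hasDerivAt_line continuous_deriv hδ
  rw [zero_smul, add_zero] at segment_bound
  refine segment_bound.trans ?_
  gcongr with t
  refine add_le_add_right (pow_le_pow_left' ?_ 2) _
  simpa [enorm_le_iff_norm_le, he] using (fderiv ℝ φ (x + t • e)).le_opNorm e

end EnergyDensity

section Trace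

variable {d : ℕ} {Ω Γ : Set (EuclideanSpace ℝ (Fin d))} {e p : EuclideanSpace ℝ (Fin d)}
  {γ : ↥(Submodule.span ℝ {e})ᗮ → ℝ} {K : ℝ≥0} {r : ℝ}

theorem lintegral_hyperplane_line (he : ‖e‖ = 1) {F : EuclideanSpace ℝ (Fin d) → ℝ≥0∞}
    (hF : Measurable F) :
    ∫⁻ y : ↥(Submodule.span ℝ {e})ᗮ, ∫⁻ t : ℝ, F (y + t • e) = ∫⁻ x, F x := by
  have splitting := (Submodule.span ℝ {e}).measurePreserving_measurableEquivProd
    (0 : EuclideanSpace ℝ (Fin d))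
  rw [InnerProductSpace.euclideanHausdorffMeasure_eq_volume] at splitting
  rw [← splitting.symm.lintegral_comp hF, Measure.volume_eq_prod,
    lintegral_prod_symm' _ (by fun_prop)]
  refine lintegral_congr fun y => ?_
  rw [← (LinearIsometryEquiv.toSpanUnitSingleton (𝕜 := ℝ) e he).measurePreserving.lintegral_comp
    (by fun_prop)]
  refine lintegral_congr fun t => congrArg F ?_
  simp [add_comm]

theorem restrict_euclideanHausdorffMeasure_le_map_graphMap (he : ‖e‖ = 1)
    (hγ : LipschitzWith K γ) {S : Set (EuclideanSpace ℝ (Fin d))}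
    (hS : ∀ x ∈ S, heightAbove e γ x = 0) :
    (Measure.euclideanHausdorffMeasure (d - 1)).restrict S ≤
      ((1 + K : ℝ≥0) : ℝ≥0∞) ^ (d - 1) •
        (volume.restrict (graphMap e γ ⁻¹' S)).map (graphMap e γ) := by
  have measurable_graphMap := (lipschitzWith_graphMap he hγ).continuous.measurable
  refine Measure.le_iff.2 fun A hA => ?_
  rw [Measure.restrict_apply hA, Measure.smul_apply, Measure.map_apply measurable_graphMap hA,
    Measure.restrict_apply (measurable_graphMap hA), smul_eq_mul, ← Set.preimage_inter]
  exact euclideanHausdorffMeasure_le_volume_preimage_graphMap he hγ fun x hx => hS x hx.2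

theorem IsGraphChart.enorm_sq_le_lintegral_line (chart : IsGraphChart Ω p e γ K r)
    {φ : EuclideanSpace ℝ (Fin d) → ℂ} (hφ : ContDiff ℝ 1 φ) {y : ↥(Submodule.span ℝ {e})ᗮ}
    (hy : graphMap e γ y ∈ Metric.ball p (r / 2)) :
    ‖φ (graphMap e γ y)‖ₑ ^ 2 ≤ ENNReal.ofReal ((r / 2)⁻¹ + 1) *
      ∫⁻ t : ℝ, Ω.indicator (energyDensity φ) (y + t • e) := by
  refine (enorm_sq_le_setLIntegral_energyDensity hφ chart.norm_eq_one (half_pos chart.pos)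
    (graphMap e γ y)).trans ?_
  gcongr _ * ?_
  rw [← lintegral_add_left_eq_self (fun t => Ω.indicator (energyDensity φ) (y + t • e)) (γ y)]
  refine (setLIntegral_mono' measurableSet_Ioc fun t ht => ?_).trans
    (setLIntegral_le_lintegral (Set.Ioc 0 (r / 2)) _)
  have mem : graphMap e γ y + t • e ∈ Ω := by
    refine chart.add_smul_mem ht.1.le ?_ ?_
    · rw [heightAbove_graphMap chart.norm_eq_one, zero_add]
      exact ht.1
    · linarith [Metric.mem_ball.1 hy, ht.2]
  rw [add_smul, ← add_assoc, ← graphMap, Set.indicator_of_mem mem]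

theorem IsGraphChart.setLIntegral_frontier_le (chart : IsGraphChart Ω p e γ K r) (hΩ : IsOpen Ω)
    {φ : EuclideanSpace ℝ (Fin d) → ℂ} (hφ : ContDiff ℝ 1 φ) :
    ∫⁻ x in Metric.ball p (r / 2) ∩ frontier Ω, ‖φ x‖ₑ ^ 2
        ∂(Measure.euclideanHausdorffMeasure (d - 1)) ≤
      ((1 + K : ℝ≥0) : ℝ≥0∞) ^ (d - 1) * ENNReal.ofReal ((r / 2)⁻¹ + 1) *
        ∫⁻ x in Ω, energyDensity φ x := by
  have he := chart.norm_eq_one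
  set S := Metric.ball p (r / 2) ∩ frontier Ω
  have height_eq_zero : ∀ x ∈ S, heightAbove e γ x = 0 := fun x hx =>
    (chart.mem_frontier_iff hΩ (Metric.ball_subset_ball (half_le_self chart.pos.le) hx.1)).1 hx.2
  have measurableSet_S : MeasurableSet S :=
    Metric.isOpen_ball.measurableSet.inter isClosed_frontier.measurableSet
  have measurable_graphMap := (lipschitzWith_graphMap he chart.lipschitzWith).continuous.measurable
  calc ∫⁻ x in S, ‖φ x‖ₑ ^ 2 ∂(Measure.euclideanHausdorffMeasure (d - 1))
      ≤ ((1 + K : ℝ≥0) : ℝ≥0∞) ^ (d - 1) *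
          ∫⁻ y in graphMap e γ ⁻¹' S, ‖φ (graphMap e γ y)‖ₑ ^ 2 := by
        refine (lintegral_mono' (restrict_euclideanHausdorffMeasure_le_map_graphMap he
          chart.lipschitzWith height_eq_zero) le_rfl).trans_eq ?_
        rw [lintegral_smul_measure, smul_eq_mul,
          lintegral_map (hφ.continuous.enorm.measurable.pow_const 2) measurable_graphMap]
    _ ≤ ((1 + K : ℝ≥0) : ℝ≥0∞) ^ (d - 1) * ∫⁻ y : ↥(Submodule.span ℝ {e})ᗮ,
          ENNReal.ofReal ((r / 2)⁻¹ + 1) *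
            ∫⁻ t : ℝ, Ω.indicator (energyDensity φ) (y + t • e) := by
        gcongr _ * ?_
        exact (setLIntegral_mono' (measurable_graphMap measurableSet_S) fun y hy =>
          chart.enorm_sq_le_lintegral_line hφ hy.1).trans (setLIntegral_le_lintegral _ _)
    _ = _ := by
        rw [lintegral_const_mul' _ _ ENNReal.ofReal_ne_top, lintegral_hyperplane_line he
          ((measurable_energyDensity hφ).indicator hΩ.measurableSet),
          lintegral_indicator hΩ.measurableSet, mul_assoc]

theorem IsBoundedLipschitzDomain.exists_trace_inequality (hΩ : IsBoundedLipschitzDomain Ω) :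
    ∃ C : ℝ≥0, ∀ φ : EuclideanSpace ℝ (Fin d) → ℂ, ContDiff ℝ 1 φ →
      ∫⁻ x in frontier Ω, ‖φ x‖ₑ ^ 2 ∂(Measure.euclideanHausdorffMeasure (d - 1)) ≤
        C * ∫⁻ x in Ω, energyDensity φ x := by
  refine hΩ.isCompact_frontier.induction_on
    (p := fun S => ∃ C : ℝ≥0, ∀ φ : EuclideanSpace ℝ (Fin d) → ℂ, ContDiff ℝ 1 φ →
      ∫⁻ x in S, ‖φ x‖ₑ ^ 2 ∂(Measure.euclideanHausdorffMeasure (d - 1)) ≤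
        C * ∫⁻ x in Ω, energyDensity φ x) ⟨0, fun φ _ => by simp⟩ ?_ ?_ ?_
  · rintro S S' hS ⟨C, hC⟩
    exact ⟨C, fun φ hφ => (lintegral_mono_set hS).trans (hC φ hφ)⟩
  · rintro S S' ⟨C, hC⟩ ⟨C', hC'⟩
    refine ⟨C + C', fun φ hφ => (lintegral_union_le _ S S').trans ?_⟩
    rw [ENNReal.coe_add, add_mul]
    exact add_le_add (hC φ hφ) (hC' φ hφ)
  · intro p hp
    obtain ⟨e, γ, K, r, chart⟩ := hΩ.exists_isGraphChart hp
    refine ⟨Metric.ball p (r / 2) ∩ frontier Ω, Set.inter_comm _ _ ▸ inter_mem_nhdsWithin _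
      (Metric.ball_mem_nhds p (half_pos chart.pos)),
      (1 + K) ^ (d - 1) * ((r / 2)⁻¹ + 1).toNNReal, fun φ hφ => ?_⟩
    rw [ENNReal.coe_mul, ENNReal.coe_pow]
    exact chart.setLIntegral_frontier_le hΩ.isOpen hφ

end Trace

/-! ### The trace operator -/

theorem setIntegral_fderiv_smul_eq_neg {E F : Type*} [NormedAddCommGroup E] [NormedSpace ℝ E]
    [FiniteDimensional ℝ E] [MeasurableSpace E] [BorelSpace E] {μ : Measure E} [μ.IsAddHaarMeasure]
    [NormedAddCommGroup F] [NormedSpace ℝ F] {S : Set E} {g : E → ℝ} {φ : E → F}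
    (hg : ContDiff ℝ 1 g) (hφ : ContDiff ℝ 1 φ) (hc : HasCompactSupport g) (hs : tsupport g ⊆ S)
    (v : E) :
    ∫ x in S, fderiv ℝ g x v • φ x ∂μ = -∫ x in S, g x • fderiv ℝ φ x v ∂μ := by
  have hg' : Continuous fun x => fderiv ℝ g x v :=
    (hg.continuous_fderiv one_ne_zero).clm_apply continuous_const
  have hφ' : Continuous fun x => fderiv ℝ φ x v :=
    (hφ.continuous_fderiv one_ne_zero).clm_apply continuous_const
  rw [setIntegral_eq_integral_of_forall_compl_eq_zero fun x hx => by
      rw [fderiv_of_notMem_tsupport ℝ fun h => hx (hs h), zero_apply, zero_smul],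
    setIntegral_eq_integral_of_forall_compl_eq_zero fun x hx => by
      rw [image_eq_zero_of_notMem_tsupport fun h => hx (hs h), zero_smul],
    integral_smul_fderiv_eq_neg_fderiv_smul_of_integrable
      ((hg'.smul hφ.continuous).integrable_of_hasCompactSupport
        (hc.fderiv_apply (𝕜 := ℝ) v).smul_right)
      ((hg.continuous.smul hφ').integrable_of_hasCompactSupport hc.smul_right)
      ((hg.continuous.smul hφ.continuous).integrable_of_hasCompactSupport hc.smul_right)
      (fun x _ => (hg.differentiable one_ne_zero).differentiableAt)
      (fun x _ => (hφ.differentiable one_ne_zero).differentiableAt), neg_neg]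

section TraceOperator

variable {d : ℕ} {Ω Γ : Set (EuclideanSpace ℝ (Fin d))} {φ : EuclideanSpace ℝ (Fin d) → ℂ}

theorem H1.grad_ae_eq_fderiv (hΩ : IsOpen Ω) (w : H1 Ω) (hφ : ContDiff ℝ 1 φ)
    (hw : H1.toFun w =ᵐ[volume.restrict Ω] φ) (i : Fin d) :
    ∀ᵐ x ∂volume.restrict Ω, H1.grad w x i = fderiv ℝ φ x (EuclideanSpace.single i 1) := by
  have hφ' : Continuous fun x => fderiv ℝ φ x (EuclideanSpace.single i 1) :=
    (hφ.continuous_fderiv one_ne_zero).clm_apply continuous_const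
  have locallyIntegrable_difference : LocallyIntegrableOn
      (fun x => H1.grad w x i - fderiv ℝ φ x (EuclideanSpace.single i 1)) Ω :=
    (locallyIntegrableOn_of_locallyIntegrable_restrict
      ((memLp_coord (H1.grad w) i).locallyIntegrable (by norm_num))).sub
      (hφ'.locallyIntegrable.locallyIntegrableOn Ω)
  rw [ae_restrict_iff' hΩ.measurableSet]
  refine (hΩ.ae_eq_zero_of_integral_contDiff_smul_eq_zero locallyIntegrable_difference
    fun g hg hc hs => ?_).mono fun x hx hxΩ => sub_eq_zero.1 (hx hxΩ)
  have weak_identity : ∫ x in Ω, fderiv ℝ g x (EuclideanSpace.single i 1) • φ x =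
      -∫ x in Ω, g x • H1.grad w x i := by
    rw [← show ∫ x in Ω, fderiv ℝ g x (EuclideanSpace.single i 1) • H1.toFun w x =
      -∫ x in Ω, g x • H1.grad w x i from w.2 g hg hc hs i]
    exact integral_congr_ae (hw.mono fun x hx => congrArg (_ • ·) hx.symm)
  rw [setIntegral_fderiv_smul_eq_neg (hg.of_le (by simp)) hφ hc hs, neg_inj] at weak_identity
  rw [← setIntegral_eq_integral_of_forall_compl_eq_zero (s := Ω) fun x hx => by
    rw [image_eq_zero_of_notMem_tsupport fun h => hx (hs h), zero_smul]]
  have integrable_deriv : Integrable (fun x => g x • fderiv ℝ φ x (EuclideanSpace.single i 1)) :=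
    (hg.continuous.smul hφ').integrable_of_hasCompactSupport hc.smul_right
  simp only [smul_sub]
  rw [integral_sub (integrable_smul_L2Dom hg.continuous hc (memLp_coord _ i))
    integrable_deriv.restrict, weak_identity, sub_self]

theorem H1.norm_fderiv_le_ae (hΩ : IsOpen Ω) (w : H1 Ω) (hφ : ContDiff ℝ 1 φ)
    (hw : H1.toFun w =ᵐ[volume.restrict Ω] φ) :
    ∀ᵐ x ∂volume.restrict Ω, ‖fderiv ℝ φ x‖ ≤ ‖H1.grad w x‖ := by
  filter_upwards [ae_all_iff.2 (H1.grad_ae_eq_fderiv hΩ w hφ hw)] with x partial_eq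
  refine ContinuousLinearMap.opNorm_le_bound _ (norm_nonneg _) fun v => ?_
  rw [map_eq_sum_smul_map_single, mul_comm]
  simp only [← partial_eq]
  exact norm_dirDeriv_le v _ x

theorem H1.lintegral_energyDensity_le (hΩ : IsOpen Ω) (w : H1 Ω) (hφ : ContDiff ℝ 1 φ)
    (hw : H1.toFun w =ᵐ[volume.restrict Ω] φ) :
    ∫⁻ x in Ω, energyDensity φ x ≤ ‖w‖ₑ ^ 2 := by
  calc ∫⁻ x in Ω, energyDensity φ x
      ≤ ∫⁻ x in Ω, (‖H1.toFun w x‖ₑ ^ 2 + ‖H1.grad w x‖ₑ ^ 2) := by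
        refine lintegral_mono_ae ?_
        filter_upwards [hw, H1.norm_fderiv_le_ae hΩ w hφ hw] with x value_eq norm_fderiv_le
        rw [energyDensity, value_eq]
        gcongr
        exact enorm_le_iff_norm_le.2 norm_fderiv_le
    _ = ‖H1.toFun w‖ₑ ^ 2 + ‖H1.grad w‖ₑ ^ 2 := by
        rw [lintegral_add_left' ((Lp.aestronglyMeasurable _).enorm.pow_const 2),
          ← eLpNorm_two_sq, ← eLpNorm_two_sq, ← Lp.enorm_def, ← Lp.enorm_def]
    _ = ‖w‖ₑ ^ 2 := by
        simp only [← ofReal_norm, ← ENNReal.ofReal_pow (norm_nonneg _), H1.norm_sq_eq]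
        rw [ENNReal.ofReal_add (by positivity) (by positivity)]

theorem IsBoundedLipschitzDomain.exists_eLpNorm_surfaceMeasure_le
    (hΩ : IsBoundedLipschitzDomain Ω) (hΓ : Γ ⊆ frontier Ω) :
    ∃ C : ℝ≥0, ∀ (w : H1 Ω) (φ : EuclideanSpace ℝ (Fin d) → ℂ), ContDiff ℝ ∞ φ →
      H1.toFun w =ᵐ[volume.restrict Ω] φ → eLpNorm φ 2 (surfaceMeasure Γ) ≤ C * ‖w‖ₑ := by
  obtain ⟨C, hC⟩ := hΩ.exists_trace_inequality
  refine ⟨C.sqrt, fun w φ hφ hw => ?_⟩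
  rw [← ENNReal.pow_le_pow_left_iff two_ne_zero, eLpNorm_two_sq, mul_pow, ← ENNReal.coe_pow,
    NNReal.sq_sqrt]
  calc ∫⁻ x, ‖φ x‖ₑ ^ 2 ∂surfaceMeasure Γ
      ≤ ∫⁻ x in frontier Ω, ‖φ x‖ₑ ^ 2 ∂(Measure.euclideanHausdorffMeasure (d - 1)) :=
        lintegral_mono_set hΓ
    _ ≤ C * ∫⁻ x in Ω, energyDensity φ x := hC φ (hφ.of_le (by simp))
    _ ≤ C * ‖w‖ₑ ^ 2 := by
        gcongr
        exact H1.lintegral_energyDensity_le hΩ.isOpen w (hφ.of_le (by simp)) hw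

/-- The pairs of an element of `H^1(Ω)` and a smooth representative of it. Restriction to `Γ` is
defined on such pairs, where it does not require a choice of representative. -/
def smoothPairs (Ω : Set (EuclideanSpace ℝ (Fin d))) :
    Submodule ℂ (H1 Ω × (EuclideanSpace ℝ (Fin d) → ℂ)) where
  carrier := {p | ContDiff ℝ ∞ p.2 ∧ H1.toFun p.1 =ᵐ[volume.restrict Ω] p.2}
  zero_mem' := ⟨contDiff_const, Lp.coeFn_zero ℂ 2 _⟩
  add_mem' := fun hp hq => ⟨hp.1.add hq.1, (Lp.coeFn_add _ _).trans (hp.2.add hq.2)⟩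
  smul_mem' := fun c _ hp => ⟨hp.1.const_smul c, (Lp.coeFn_smul c _).trans (hp.2.const_smul c)⟩

theorem exists_continuousLinearMap_eq_of_norm_le {𝕜 P H F : Type*} [RCLike 𝕜] [AddCommGroup P]
    [Module 𝕜 P] [NormedAddCommGroup H] [InnerProductSpace 𝕜 H] [CompleteSpace H]
    [NormedAddCommGroup F] [NormedSpace 𝕜 F] [CompleteSpace F] (ι : P →ₗ[𝕜] H) (f : P →ₗ[𝕜] F)
    {C : ℝ} (hf : ∀ p, ‖f p‖ ≤ C * ‖ι p‖) : ∃ T : H →L[𝕜] F, ∀ p, T (ι p) = f p := by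
  let K : Submodule 𝕜 H := (LinearMap.range ι).topologicalClosure
  have : CompleteSpace K := (LinearMap.range ι).isClosed_topologicalClosure.completeSpace_coe
  let ιK : P →ₗ[𝕜] K := ι.codRestrict K fun p =>
    (LinearMap.range ι).le_topologicalClosure (LinearMap.mem_range_self ι p)
  have denseRange_ιK : DenseRange ιK := fun x => by
    rw [closure_subtype, ← Set.range_comp]
    exact x.2
  refine ⟨(f.extendOfNorm ιK).comp K.orthogonalProjectionOnto, fun p => ?_⟩
  have projection_eq : K.orthogonalProjectionOnto (ι p) = ιK p :=
    Submodule.orthogonalProjectionOnto_mem_subspace_eq_self (ιK p)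
  rw [ContinuousLinearMap.comp_apply, projection_eq]
  exact LinearMap.extendOfNorm_eq denseRange_ιK ⟨C, hf⟩ p

theorem IsBoundedLipschitzDomain.exists_isTraceOp (hΩ : IsBoundedLipschitzDomain Ω)
    (hΓ : Γ ⊆ frontier Ω) : ∃ T, IsTraceOp Ω Γ T := by
  obtain ⟨C, hC⟩ := hΩ.exists_eLpNorm_surfaceMeasure_le hΓ
  have memLp (p : smoothPairs Ω) : MemLp p.1.2 2 (surfaceMeasure Γ) :=
    ⟨p.2.1.continuous.aestronglyMeasurable,
      (hC _ _ p.2.1 p.2.2).trans_lt (ENNReal.mul_lt_top ENNReal.coe_lt_top enorm_lt_top)⟩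
  let restriction : smoothPairs Ω →ₗ[ℂ] L2Bd Γ :=
    { toFun := fun p => (memLp p).toLp p.1.2
      map_add' := fun p q => MemLp.toLp_add (memLp p) (memLp q)
      map_smul' := fun c p => MemLp.toLp_const_smul c (memLp p) }
  have norm_restriction_le (p : smoothPairs Ω) : ‖restriction p‖ ≤ C * ‖p.1.1‖ := by
    change ‖(memLp p).toLp p.1.2‖ ≤ C * ‖p.1.1‖
    rw [Lp.norm_toLp]
    refine ENNReal.toReal_le_of_le_ofReal (by positivity) ((hC _ _ p.2.1 p.2.2).trans_eq ?_)
    rw [ENNReal.ofReal_mul C.coe_nonneg, ofReal_norm, ENNReal.ofReal_coe_nnreal]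
  obtain ⟨T, hT⟩ := exists_continuousLinearMap_eq_of_norm_le
    (LinearMap.fst ℂ _ _ ∘ₗ (smoothPairs Ω).subtype) restriction norm_restriction_le
  refine ⟨T, fun w φ hφ hw => ?_⟩
  have trace_eq : T w = restriction ⟨(w, φ), hφ, hw⟩ := hT ⟨(w, φ), hφ, hw⟩
  rw [trace_eq]
  exact (memLp _).coeFn_toLp

theorem IsBoundedLipschitzDomain.isTraceOp_traceOp (hΩ : IsBoundedLipschitzDomain Ω)
    (hΓ : Γ ⊆ frontier Ω) : IsTraceOp Ω Γ (traceOp Ω Γ) :=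
  Classical.epsilon_spec (hΩ.exists_isTraceOp hΓ)

end TraceOperator

/-! ### Mean-free functions -/

section MeanFree

variable {d : ℕ} {Ω Γ : Set (EuclideanSpace ℝ (Fin d))} [IsFiniteMeasure (surfaceMeasure Γ)]

variable (Γ) in
/-- The functional `g ↦ ∫_Γ g dS` on `L^2(Γ)`. -/
noncomputable def surfaceIntegral : L2Bd Γ →L[ℂ] ℂ :=
  innerSL ℂ (Lp.const 2 (surfaceMeasure Γ) (1 : ℂ))

theorem surfaceIntegral_apply (g : L2Bd Γ) :
    surfaceIntegral Γ g = ∫ x, g x ∂(surfaceMeasure Γ) := by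
  rw [surfaceIntegral, innerSL_apply_apply, L2.inner_def]
  refine integral_congr_ae ?_
  filter_upwards [Lp.coeFn_const 2 (surfaceMeasure Γ) (1 : ℂ)] with x hx
  rw [hx]
  simp

theorem surfaceIntegral_const (c : ℂ) :
    surfaceIntegral Γ (Lp.const 2 (surfaceMeasure Γ) c) =
      ((surfaceMeasure Γ).real Set.univ : ℂ) * c := by
  rw [surfaceIntegral_apply, integral_congr_ae (Lp.coeFn_const 2 (surfaceMeasure Γ) c)]
  simp

theorem measureReal_surfaceMeasure_ne_zero [NeZero (surfaceMeasure Γ)] :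
    ((surfaceMeasure Γ).real Set.univ : ℂ) ≠ 0 :=
  Complex.ofReal_ne_zero.2 measureReal_univ_pos.ne'

theorem mem_L2Mean_iff {g : L2Bd Γ} : g ∈ L2Mean Γ ↔ surfaceIntegral Γ g = 0 := by
  rw [surfaceIntegral_apply]
  exact ⟨fun h => h.2, fun h => ⟨(Lp.memLp g).integrable (by norm_num), h⟩⟩

theorem mem_H1Mean_iff {w : H1 Ω} : w ∈ H1Mean Ω Γ ↔ surfaceIntegral Γ (traceOp Ω Γ w) = 0 :=
  mem_L2Mean_iff

theorem isClosed_H1Mean : IsClosed (H1Mean Ω Γ : Set (H1 Ω)) := by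
  have : (H1Mean Ω Γ : Set (H1 Ω)) = {w | surfaceIntegral Γ (traceOp Ω Γ w) = 0} :=
    Set.ext fun _ => mem_H1Mean_iff
  rw [this]
  exact isClosed_eq (by fun_prop) continuous_const

instance : CompleteSpace (H1Mean Ω Γ) :=
  (isClosed_H1Mean (Ω := Ω) (Γ := Γ)).completeSpace_coe

theorem inner_const_of_mem_L2Mean {f : L2Bd Γ} (hf : f ∈ L2Mean Γ) (c : ℂ) :
    inner ℂ (Lp.const 2 (surfaceMeasure Γ) c) f = 0 := by
  have hc : Lp.const 2 (surfaceMeasure Γ) c = c • Lp.const 2 (surfaceMeasure Γ) (1 : ℂ) := by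
    simpa using (Lp.constL 2 (surfaceMeasure Γ) ℂ).map_smul c (1 : ℂ)
  rw [hc, inner_smul_left]
  exact mul_eq_zero_of_right _ (mem_L2Mean_iff.1 hf)

variable [IsFiniteMeasure ((volume : Measure (EuclideanSpace ℝ (Fin d))).restrict Ω)]

theorem traceOp_constL (hT : IsTraceOp Ω Γ (traceOp Ω Γ)) (c : ℂ) :
    traceOp Ω Γ (H1.constL Ω c) = Lp.const 2 (surfaceMeasure Γ) c :=
  Lp.ext ((hT _ _ contDiff_const (Lp.coeFn_const 2 _ c)).trans (Lp.coeFn_const 2 _ c).symm)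

variable (Ω Γ) in
/-- The projection `v ↦ v - |Γ|⁻¹ ∫_Γ T v dS` of `H^1(Ω)` onto `H^1_⋄(Ω)` along the constants. -/
noncomputable def meanFreePart : H1 Ω →L[ℂ] H1 Ω :=
  .id ℂ (H1 Ω) - H1.constL Ω ∘L
    (((surfaceMeasure Γ).real Set.univ : ℂ)⁻¹ • (surfaceIntegral Γ ∘L traceOp Ω Γ))

theorem meanFreePart_apply (v : H1 Ω) :
    meanFreePart Ω Γ v = v - H1.constL Ω
      (((surfaceMeasure Γ).real Set.univ : ℂ)⁻¹ * surfaceIntegral Γ (traceOp Ω Γ v)) := rfl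

theorem grad_meanFreePart (v : H1 Ω) : H1.grad (meanFreePart Ω Γ v) = H1.grad v :=
  H1.grad_sub_constL v _

theorem meanFreePart_of_mem {w : H1 Ω} (hw : w ∈ H1Mean Ω Γ) : meanFreePart Ω Γ w = w := by
  rw [meanFreePart_apply, mem_H1Mean_iff.1 hw, mul_zero, map_zero, sub_zero]

theorem inner_traceOp_meanFreePart (hT : IsTraceOp Ω Γ (traceOp Ω Γ)) (v : H1 Ω)
    {f : L2Bd Γ} (hf : f ∈ L2Mean Γ) :
    inner ℂ (traceOp Ω Γ (meanFreePart Ω Γ v)) f = inner ℂ (traceOp Ω Γ v) f := by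
  rw [meanFreePart_apply, map_sub, traceOp_constL hT, inner_sub_left,
    inner_const_of_mem_L2Mean hf, sub_zero]

variable [NeZero (surfaceMeasure Γ)]

theorem meanFreePart_mem_H1Mean (hT : IsTraceOp Ω Γ (traceOp Ω Γ)) (v : H1 Ω) :
    meanFreePart Ω Γ v ∈ H1Mean Ω Γ := by
  rw [mem_H1Mean_iff, meanFreePart_apply, map_sub, map_sub, traceOp_constL hT,
    surfaceIntegral_const, mul_inv_cancel_left₀ measureReal_surfaceMeasure_ne_zero, sub_self]

theorem meanFreePart_constL (hT : IsTraceOp Ω Γ (traceOp Ω Γ)) (c : ℂ) :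
    meanFreePart Ω Γ (H1.constL Ω c) = 0 := by
  rw [meanFreePart_apply, traceOp_constL hT, surfaceIntegral_const,
    inv_mul_cancel_left₀ measureReal_surfaceMeasure_ne_zero, sub_self]

end MeanFree

/-! ### The variational problems on `H^1_⋄(Ω)` -/

section Variational

variable {d : ℕ} {Ω Γ : Set (EuclideanSpace ℝ (Fin d))}

/-- The weak gradient on `H^1_⋄(Ω)`. -/
noncomputable def gradMean (Ω Γ : Set (EuclideanSpace ℝ (Fin d))) : H1Mean Ω Γ →L[ℂ] L2VecDom Ω :=
  gradL Ω ∘L (H1Mean Ω Γ).subtypeL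

theorem gradMean_apply (w : H1Mean Ω Γ) : gradMean Ω Γ w = H1.grad (w : H1 Ω) := rfl

variable [IsFiniteMeasure (surfaceMeasure Γ)]

/-- The operators on `H^1_⋄(Ω)` representing the forms `⟨·, ·⟩_B`. -/
noncomputable def formOp (Ω Γ : Set (EuclideanSpace ℝ (Fin d)))
    [IsFiniteMeasure (surfaceMeasure Γ)] : Coeff Ω →L[ℂ] H1Mean Ω Γ →L[ℂ] H1Mean Ω Γ :=
  sandwich (gradMean Ω Γ) (coeffMul Ω)

theorem inner_formOp (B : Coeff Ω) (w v : H1Mean Ω Γ) :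
    inner ℂ v (formOp Ω Γ B w) = coeffForm B (w : H1 Ω) (v : H1 Ω) := by
  rw [coeffForm_eq_inner]
  exact inner_sandwich (gradMean Ω Γ) (coeffMul Ω) B w v

/-- The operator representing the functionals `v ↦ ⟨f, T v⟩`. -/
noncomputable def loadOp (Ω Γ : Set (EuclideanSpace ℝ (Fin d)))
    [IsFiniteMeasure (surfaceMeasure Γ)] : L2Mean Γ →L[ℂ] H1Mean Ω Γ :=
  ContinuousLinearMap.adjoint (traceOp Ω Γ ∘L (H1Mean Ω Γ).subtypeL) ∘L (L2Mean Γ).subtypeL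

theorem inner_loadOp (f : L2Mean Γ) (v : H1Mean Ω Γ) :
    inner ℂ v (loadOp Ω Γ f) = inner ℂ (traceOp Ω Γ (v : H1 Ω)) (f : L2Bd Γ) :=
  ContinuousLinearMap.adjoint_inner_right (traceOp Ω Γ ∘L (H1Mean Ω Γ).subtypeL) v (f : L2Bd Γ)

section TestFunctions

variable [IsFiniteMeasure ((volume : Measure (EuclideanSpace ℝ (Fin d))).restrict Ω)]
  [NeZero (surfaceMeasure Γ)] (hT : IsTraceOp Ω Γ (traceOp Ω Γ))
include hT

theorem isWeakSolution_iff_formOp (A : Coeff Ω) (f : L2Mean Γ) (u : H1Mean Ω Γ) :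
    IsWeakSolution A f u ↔ formOp Ω Γ A u = loadOp Ω Γ f := by
  constructor
  · intro h
    refine ext_inner_left ℂ fun v => ?_
    rw [inner_formOp, inner_loadOp]
    exact h v
  · intro h v
    have tested := inner_formOp A u ⟨_, meanFreePart_mem_H1Mean hT v⟩
    rw [h, inner_loadOp, inner_traceOp_meanFreePart hT v f.2] at tested
    rw [tested, coeffForm_eq_inner, coeffForm_eq_inner, grad_meanFreePart]

theorem isPerturbSolution_iff_formOp (A B : Coeff Ω) (y z : H1Mean Ω Γ) :
    IsPerturbSolution A B y z ↔ formOp Ω Γ A z = -formOp Ω Γ B y := by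
  constructor
  · intro h
    refine ext_inner_left ℂ fun v => ?_
    rw [inner_formOp, inner_neg_right, inner_formOp]
    exact h v
  · intro h v
    have tested := inner_formOp A z ⟨_, meanFreePart_mem_H1Mean hT v⟩
    rw [h, inner_neg_right, inner_formOp] at tested
    simp only [coeffForm_eq_inner, grad_meanFreePart] at tested ⊢
    exact tested.symm

end TestFunctions

variable {K : ℝ≥0} (hD : AntilipschitzWith K (gradMean Ω Γ)) {A : Coeff Ω}
include hD

theorem isUnit_formOp (hA : A ∈ ellipticCoeff Ω) : IsUnit (formOp Ω Γ A) := by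
  obtain ⟨c, hc, hAc⟩ := hA
  exact isUnit_sandwich hD hc hAc.le_re_inner

variable [IsFiniteMeasure ((volume : Measure (EuclideanSpace ℝ (Fin d))).restrict Ω)]
  [NeZero (surfaceMeasure Γ)] (hT : IsTraceOp Ω Γ (traceOp Ω Γ))
include hT

theorem isWeakSolution_iff_eq_inverse (hA : A ∈ ellipticCoeff Ω) (f : L2Mean Γ)
    (u : H1Mean Ω Γ) :
    IsWeakSolution A f u ↔ u = ((formOp Ω Γ A)⁻¹ʳ ∘L loadOp Ω Γ) f := by
  rw [isWeakSolution_iff_formOp hT, apply_eq_iff_eq_inverse_apply (isUnit_formOp hD hA)]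
  rfl

theorem isPerturbSolution_iff_eq_relPerturb (hA : A ∈ ellipticCoeff Ω) (B : Coeff Ω)
    (y z : H1Mean Ω Γ) :
    IsPerturbSolution A B y z ↔ z = relPerturb (formOp Ω Γ) A B y := by
  rw [isPerturbSolution_iff_formOp hT, apply_eq_iff_eq_inverse_apply (isUnit_formOp hD hA),
    map_neg]
  rfl

theorem solOp_eq (hA : A ∈ ellipticCoeff Ω) :
    solOp Ω Γ A = (formOp Ω Γ A)⁻¹ʳ ∘L loadOp Ω Γ := by
  have solves := Classical.epsilon_spec
    (p := fun S : L2Mean Γ →L[ℂ] H1Mean Ω Γ => ∀ f, IsWeakSolution A f (S f))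
    ⟨_, fun f => (isWeakSolution_iff_eq_inverse hD hT hA f _).2 rfl⟩
  ext1 f
  exact (isWeakSolution_iff_eq_inverse hD hT hA f _).1 (solves f)

theorem perturbOp_eq (hA : A ∈ ellipticCoeff Ω) :
    perturbOp Ω Γ A = relPerturb (formOp Ω Γ) A := by
  have solves := Classical.epsilon_spec
    (p := fun P : Coeff Ω →L[ℂ] H1Mean Ω Γ →L[ℂ] H1Mean Ω Γ =>
      ∀ B y, IsPerturbSolution A B y (P B y))
    ⟨_, fun B y => (isPerturbSolution_iff_eq_relPerturb hD hT hA B y _).2 rfl⟩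
  ext1 B
  ext1 y
  exact (isPerturbSolution_iff_eq_relPerturb hD hT hA B y _).1 (solves B y)

theorem isWeakSolution_iff_eq_solOp (hA : A ∈ ellipticCoeff Ω) (f : L2Mean Γ)
    (u : H1Mean Ω Γ) : IsWeakSolution A f u ↔ u = solOp Ω Γ A f := by
  rw [solOp_eq hD hT hA, isWeakSolution_iff_eq_inverse hD hT hA]

theorem isPerturbSolution_iff_eq_perturbOp (hA : A ∈ ellipticCoeff Ω) (B : Coeff Ω)
    (y z : H1Mean Ω Γ) : IsPerturbSolution A B y z ↔ z = perturbOp Ω Γ A B y := by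
  rw [perturbOp_eq hD hT hA, isPerturbSolution_iff_eq_relPerturb hD hT hA]

/-! ### Analyticity and Taylor series -/

theorem solOp_eventuallyEq (hA : A ∈ ellipticCoeff Ω) :
    solOp Ω Γ =ᶠ[𝓝 A] fun A' => (formOp Ω Γ A')⁻¹ʳ ∘L loadOp Ω Γ := by
  filter_upwards [isOpen_ellipticCoeff.mem_nhds hA] with A' hA'
  exact solOp_eq hD hT hA'

theorem analyticOnNhd_solOp : AnalyticOnNhd ℂ (solOp Ω Γ) (ellipticCoeff Ω) := fun _ hA =>
  (hasFPowerSeriesAt_inverse_comp _ _ (isUnit_formOp hD hA)).analyticAt.congr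
    (solOp_eventuallyEq hD hT hA).symm

theorem analyticOnNhd_ndMap : AnalyticOnNhd ℂ (ndMap Ω Γ) (ellipticCoeff Ω) := fun A hA =>
  analyticAt_compL (analyticOnNhd_solOp hD hT A hA) (traceMean Ω Γ)

theorem iteratedFDeriv_solOp_eq (hA : A ∈ ellipticCoeff Ω) (k : ℕ) :
    iteratedFDeriv ℂ k (solOp Ω Γ) A =
      iteratedFDeriv ℂ k (fun A' => (formOp Ω Γ A')⁻¹ʳ ∘L loadOp Ω Γ) A :=
  Filter.EventuallyEq.eq_of_nhds
    (Filter.EventuallyEq.iteratedFDeriv ℂ (solOp_eventuallyEq hD hT hA) k)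

theorem iteratedFDeriv_solOp (hA : A ∈ ellipticCoeff Ω) (k : ℕ) (B : Fin k → Coeff Ω) :
    iteratedFDeriv ℂ k (solOp Ω Γ) A B =
      (∑ α : Equiv.Perm (Fin k),
        (List.ofFn fun i : Fin k => perturbOp Ω Γ A (B (α i))).prod) ∘L solOp Ω Γ A := by
  rw [iteratedFDeriv_solOp_eq hD hT hA, perturbOp_eq hD hT hA,
    solOp_eq hD hT hA, iteratedFDeriv_inverse_comp _ _ (isUnit_formOp hD hA)]

theorem iteratedFDeriv_ndMap (hA : A ∈ ellipticCoeff Ω) (k : ℕ) (B : Fin k → Coeff Ω) :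
    iteratedFDeriv ℂ k (ndMap Ω Γ) A B =
      traceMean Ω Γ ∘L iteratedFDeriv ℂ k (solOp Ω Γ) A B :=
  iteratedFDeriv_compL_apply (analyticOnNhd_solOp hD hT A hA).contDiffAt (traceMean Ω Γ) B

theorem inv_factorial_smul_iteratedFDeriv_solOp (hA : A ∈ ellipticCoeff Ω) (B : Coeff Ω)
    (k : ℕ) :
    ((k.factorial : ℂ)⁻¹) • iteratedFDeriv ℂ k (solOp Ω Γ) A (fun _ => B) =
      (perturbOp Ω Γ A B ^ k) ∘L solOp Ω Γ A := by
  have hk : (k.factorial : ℂ) ≠ 0 := Nat.cast_ne_zero.2 k.factorial_ne_zero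
  rw [iteratedFDeriv_solOp_eq hD hT hA,
    iteratedFDeriv_inverse_comp_const _ _ (isUnit_formOp hD hA), perturbOp_eq hD hT hA,
    solOp_eq hD hT hA, ← Nat.cast_smul_eq_nsmul ℂ, inv_smul_smul₀ hk]

theorem hasSum_perturbOp_pow {c : ℝ} (hc : 0 < c) (hA : IsEllipticityConst A c) {B : Coeff Ω}
    (hB : ‖B‖ < c) :
    HasSum (fun k : ℕ => (perturbOp Ω Γ A B ^ k) ∘L solOp Ω Γ A) (solOp Ω Γ (A + B)) := by
  have hA' : A ∈ ellipticCoeff Ω := ⟨c, hc, hA⟩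
  have hAB : A + B ∈ ellipticCoeff Ω := ⟨_, sub_pos.2 hB, hA.add B⟩
  have small : ‖coeffMul Ω B‖ < c :=
    (ContinuousLinearMap.opNorm_le_bound _ (norm_nonneg B)
      (norm_coeffMul_apply_le B)).trans_lt hB
  rw [perturbOp_eq hD hT hA', solOp_eq hD hT hA', solOp_eq hD hT hAB]
  exact hasSum_relPerturb_pow_comp _ _ (isUnit_formOp hD hA')
    (summable_relPerturb_sandwich_pow hD hc hA.le_re_inner small)

theorem hasSum_taylor_solOp {c : ℝ} (hc : 0 < c) (hA : IsEllipticityConst A c) {B : Coeff Ω}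
    (hB : ‖B‖ < c) :
    HasSum (fun k : ℕ => ((k.factorial : ℂ)⁻¹) • iteratedFDeriv ℂ k (solOp Ω Γ) A (fun _ => B))
      (solOp Ω Γ (A + B)) := by
  simp only [inv_factorial_smul_iteratedFDeriv_solOp hD hT ⟨c, hc, hA⟩]
  exact hasSum_perturbOp_pow hD hT hc hA hB

theorem hasSum_taylor_ndMap {c : ℝ} (hc : 0 < c) (hA : IsEllipticityConst A c) {B : Coeff Ω}
    (hB : ‖B‖ < c) :
    HasSum (fun k : ℕ => ((k.factorial : ℂ)⁻¹) • iteratedFDeriv ℂ k (ndMap Ω Γ) A (fun _ => B))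
      (ndMap Ω Γ (A + B)) := by
  simp only [iteratedFDeriv_ndMap hD hT ⟨c, hc, hA⟩, ← ContinuousLinearMap.comp_smul]
  exact (hasSum_taylor_solOp hD hT hc hA hB).mapL
    (ContinuousLinearMap.compL ℂ _ _ _ (traceMean Ω Γ))

theorem ndMap_add_eq {c : ℝ} (hc : 0 < c) (hA : IsEllipticityConst A c) {B : Coeff Ω}
    (hB : ‖B‖ < c) :
    ndMap Ω Γ (A + B) =
      traceMean Ω Γ ∘L (∑' k : ℕ, (perturbOp Ω Γ A B ^ k) ∘L solOp Ω Γ A) :=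
  congrArg (traceMean Ω Γ ∘L ·) (hasSum_perturbOp_pow hD hT hc hA hB).tsum_eq.symm

end Variational

/-! ### The Poincaré inequality on `H^1_⋄(Ω)` -/

section Poincare

variable {d : ℕ} {Ω Γ : Set (EuclideanSpace ℝ (Fin d))}

theorem H1.norm_le_add (w : H1 Ω) : ‖w‖ ≤ ‖H1.toFun w‖ + ‖H1.grad w‖ := by
  refine (pow_le_pow_iff_left₀ (norm_nonneg w) (by positivity) two_ne_zero).1 ?_
  rw [H1.norm_sq_eq]
  nlinarith [norm_nonneg (H1.toFun w), norm_nonneg (H1.grad w)]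

variable [IsFiniteMeasure ((volume : Measure (EuclideanSpace ℝ (Fin d))).restrict Ω)]

theorem IsBoundedLipschitzDomain.exists_norm_sub_constL_le (hΩ : IsBoundedLipschitzDomain Ω) :
    ∃ C : ℝ≥0, ∀ w : H1 Ω, ∃ c : ℂ, ‖w - H1.constL Ω c‖ ≤ C * ‖H1.grad w‖ := by
  obtain ⟨x₀, hx₀⟩ := hΩ.isConnected.nonempty
  obtain ⟨r, hr, hball⟩ := Metric.isOpen_iff.1 hΩ.isOpen x₀ hx₀
  obtain ⟨C₁, hC₁⟩ := IsControlled.domain hΩ hr hx₀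
  obtain ⟨C₂, hC₂⟩ := exists_const_eLpNorm_sub_le_of_convex hΩ.isOpen.measurableSet
    Metric.isOpen_ball (convex_ball x₀ r) Metric.isBounded_ball (Metric.nonempty_ball.2 hr) hball
  refine ⟨C₁ * (1 + C₂) + 1, fun w => ?_⟩
  obtain ⟨c, hc⟩ := hC₂ w
  refine ⟨c, ?_⟩
  have toFun_enorm_le :
      ‖H1.toFun (w - H1.constL Ω c)‖ₑ ≤ (C₁ * (1 + C₂) : ℝ≥0) * ‖H1.grad w‖ₑ := by
    calc ‖H1.toFun (w - H1.constL Ω c)‖ₑ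
        ≤ C₁ * (‖H1.grad w‖ₑ +
            eLpNorm (H1.toFun (w - H1.constL Ω c)) 2 (volume.restrict (Metric.ball x₀ r))) := by
          simpa only [Lp.enorm_def, H1.grad_sub_constL] using hC₁ (w - H1.constL Ω c)
      _ ≤ C₁ * (‖H1.grad w‖ₑ + C₂ * ‖H1.grad w‖ₑ) := by
          gcongr _ * (_ + ?_)
          rwa [eLpNorm_congr_ae (ae_restrict_of_ae_restrict_of_subset hball
            (H1.toFun_sub_constL_ae_eq w c))]
      _ = (C₁ * (1 + C₂) : ℝ≥0) * ‖H1.grad w‖ₑ := by push_cast; ring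
  have toFun_norm_le : ‖H1.toFun (w - H1.constL Ω c)‖ ≤ (C₁ * (1 + C₂) : ℝ≥0) * ‖H1.grad w‖ := by
    simpa only [ENNReal.toReal_mul, toReal_enorm, ENNReal.coe_toReal] using
      ENNReal.toReal_mono (by finiteness) toFun_enorm_le
  have norm_le := H1.norm_le_add (w - H1.constL Ω c)
  rw [H1.grad_sub_constL] at norm_le
  push_cast at toFun_norm_le ⊢
  linarith

theorem IsBoundedLipschitzDomain.exists_antilipschitzWith_gradMean
    [IsFiniteMeasure (surfaceMeasure Γ)] [NeZero (surfaceMeasure Γ)]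
    (hΩ : IsBoundedLipschitzDomain Ω) (hT : IsTraceOp Ω Γ (traceOp Ω Γ)) :
    ∃ K : ℝ≥0, AntilipschitzWith K (gradMean Ω Γ) := by
  obtain ⟨C, hC⟩ := hΩ.exists_norm_sub_constL_le
  refine ⟨‖meanFreePart Ω Γ‖₊ * C, (gradMean Ω Γ).antilipschitz_of_bound fun w => ?_⟩
  obtain ⟨c, hc⟩ := hC w
  calc ‖w‖ = ‖meanFreePart Ω Γ (w - H1.constL Ω c)‖ := by
        rw [map_sub, meanFreePart_of_mem w.2, meanFreePart_constL hT, sub_zero]; rfl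
    _ ≤ ‖meanFreePart Ω Γ‖ * (C * ‖H1.grad (w : H1 Ω)‖) :=
        (meanFreePart Ω Γ).le_opNorm_of_le hc
    _ = (‖meanFreePart Ω Γ‖₊ * C : ℝ≥0) * ‖gradMean Ω Γ w‖ := by
        rw [gradMean_apply, NNReal.coe_mul, coe_nnnorm, mul_assoc]

end Poincare

theorem mainTheorem1_general {d : ℕ} {Ω Γ : Set (EuclideanSpace ℝ (Fin d))}
    (hΩ : IsBoundedLipschitzDomain Ω) (hΓ : Γ ⊆ frontier Ω) (hΓ₀ : surfaceMeasure Γ ≠ 0) :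
    IsTraceOp Ω Γ (traceOp Ω Γ) ∧
    (∃ C : ℝ, ∀ w : H1Mean Ω Γ, ‖w‖ ^ 2 ≤ C * ‖H1.grad (w : H1 Ω)‖ ^ 2) ∧
    (∀ A ∈ ellipticCoeff Ω,
      (∀ (f : L2Mean Γ) (u : H1Mean Ω Γ), IsWeakSolution A f u ↔ u = solOp Ω Γ A f) ∧
      (∀ (B : Coeff Ω) (y z : H1Mean Ω Γ),
        IsPerturbSolution A B y z ↔ z = perturbOp Ω Γ A B y)) ∧
    IsOpen (ellipticCoeff Ω) ∧
    ContDiffOn ℂ ∞ (solOp Ω Γ) (ellipticCoeff Ω) ∧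
    ContDiffOn ℂ ∞ (ndMap Ω Γ) (ellipticCoeff Ω) ∧
    AnalyticOnNhd ℂ (solOp Ω Γ) (ellipticCoeff Ω) ∧
    AnalyticOnNhd ℂ (ndMap Ω Γ) (ellipticCoeff Ω) ∧
    (∀ A ∈ ellipticCoeff Ω, ∀ (k : ℕ) (B : Fin k → Coeff Ω),
      iteratedFDeriv ℂ k (solOp Ω Γ) A B =
        (∑ α : Equiv.Perm (Fin k),
          (List.ofFn fun i : Fin k => perturbOp Ω Γ A (B (α i))).prod) ∘L solOp Ω Γ A ∧
      iteratedFDeriv ℂ k (ndMap Ω Γ) A B =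
        traceMean Ω Γ ∘L iteratedFDeriv ℂ k (solOp Ω Γ) A B) ∧
    (∀ A ∈ ellipticCoeff Ω, ∀ c : ℝ, 0 < c → IsEllipticityConst A c →
      ∀ B : Coeff Ω, ‖B‖ < c →
        A + B ∈ ellipticCoeff Ω ∧
        HasSum (fun k : ℕ =>
          ((k.factorial : ℂ)⁻¹) • iteratedFDeriv ℂ k (solOp Ω Γ) A (fun _ => B))
          (solOp Ω Γ (A + B)) ∧
        HasSum (fun k : ℕ => (perturbOp Ω Γ A B ^ k) ∘L solOp Ω Γ A) (solOp Ω Γ (A + B)) ∧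
        HasSum (fun k : ℕ =>
          ((k.factorial : ℂ)⁻¹) • iteratedFDeriv ℂ k (ndMap Ω Γ) A (fun _ => B))
          (ndMap Ω Γ (A + B)) ∧
        ndMap Ω Γ (A + B) =
          traceMean Ω Γ ∘L (∑' k : ℕ, (perturbOp Ω Γ A B ^ k) ∘L solOp Ω Γ A)) := by
  have : IsFiniteMeasure (volume.restrict Ω) :=
    isFiniteMeasure_restrict.2 hΩ.isBounded.measure_lt_top.ne
  have : IsFiniteMeasure (surfaceMeasure Γ) := isFiniteMeasure_surfaceMeasure hΩ hΓ
  have : NeZero (surfaceMeasure Γ) := ⟨hΓ₀⟩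
  have hT : IsTraceOp Ω Γ (traceOp Ω Γ) := hΩ.isTraceOp_traceOp hΓ
  obtain ⟨K, hD⟩ := hΩ.exists_antilipschitzWith_gradMean hT
  have poincare (w : H1Mean Ω Γ) : ‖w‖ ^ 2 ≤ (K : ℝ) ^ 2 * ‖H1.grad (w : H1 Ω)‖ ^ 2 := by
    rw [← mul_pow, ← gradMean_apply]
    gcongr
    exact hD.le_mul_norm (map_zero _) w
  have analytic_N := analyticOnNhd_solOp hD hT
  have analytic_Λ := analyticOnNhd_ndMap hD hT
  exact ⟨hT, ⟨_, poincare⟩, fun A hA => ⟨isWeakSolution_iff_eq_solOp hD hT hA,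
    isPerturbSolution_iff_eq_perturbOp hD hT hA⟩, isOpen_ellipticCoeff,
    analytic_N.contDiffOn isOpen_ellipticCoeff.uniqueDiffOn,
    analytic_Λ.contDiffOn isOpen_ellipticCoeff.uniqueDiffOn, analytic_N, analytic_Λ,
    fun A hA k B => ⟨iteratedFDeriv_solOp hD hT hA k B, iteratedFDeriv_ndMap hD hT hA k B⟩,
    fun A _ c hc hAc B hB => ⟨⟨_, sub_pos.2 hB, hAc.add B⟩, hasSum_taylor_solOp hD hT hc hAc hB,
      hasSum_perturbOp_pow hD hT hc hAc hB, hasSum_taylor_ndMap hD hT hc hAc hB,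
      ndMap_add_eq hD hT hc hAc hB⟩⟩

theorem mainTheorem1 {d : ℕ} (hd : 2 ≤ d) (Ω Γ : Set (EuclideanSpace ℝ (Fin d)))
    (hΩ : IsBoundedLipschitzDomain Ω) (hΓ : IsRelOpenBoundary Ω Γ) (hΓne : Γ.Nonempty) :
    -- the objects are well defined
    IsTraceOp Ω Γ (traceOp Ω Γ) ∧
    (∃ C : ℝ, ∀ w : H1Mean Ω Γ, ‖w‖ ^ 2 ≤ C * ‖H1.grad (w : H1 Ω)‖ ^ 2) ∧
    (∀ A ∈ ellipticCoeff Ω,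
      (∀ (f : L2Mean Γ) (u : H1Mean Ω Γ), IsWeakSolution A f u ↔ u = solOp Ω Γ A f) ∧
      (∀ (B : Coeff Ω) (y z : H1Mean Ω Γ),
        IsPerturbSolution A B y z ↔ z = perturbOp Ω Γ A B y)) ∧
    -- smoothness and analyticity on the open set of elliptic coefficients
    IsOpen (ellipticCoeff Ω) ∧
    ContDiffOn ℂ ∞ (solOp Ω Γ) (ellipticCoeff Ω) ∧
    ContDiffOn ℂ ∞ (ndMap Ω Γ) (ellipticCoeff Ω) ∧
    AnalyticOnNhd ℂ (solOp Ω Γ) (ellipticCoeff Ω) ∧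
    AnalyticOnNhd ℂ (ndMap Ω Γ) (ellipticCoeff Ω) ∧
    -- the derivatives
    (∀ A ∈ ellipticCoeff Ω, ∀ (k : ℕ) (B : Fin k → Coeff Ω),
      iteratedFDeriv ℂ k (solOp Ω Γ) A B =
        (∑ α : Equiv.Perm (Fin k),
          (List.ofFn fun i : Fin k => perturbOp Ω Γ A (B (α i))).prod) ∘L solOp Ω Γ A ∧
      iteratedFDeriv ℂ k (ndMap Ω Γ) A B =
        traceMean Ω Γ ∘L iteratedFDeriv ℂ k (solOp Ω Γ) A B) ∧
    -- the Taylor series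
    (∀ A ∈ ellipticCoeff Ω, ∀ c : ℝ, 0 < c → IsEllipticityConst A c →
      ∀ B : Coeff Ω, ‖B‖ < c →
        A + B ∈ ellipticCoeff Ω ∧
        HasSum (fun k : ℕ =>
          ((k.factorial : ℂ)⁻¹) • iteratedFDeriv ℂ k (solOp Ω Γ) A (fun _ => B))
          (solOp Ω Γ (A + B)) ∧
        HasSum (fun k : ℕ => (perturbOp Ω Γ A B ^ k) ∘L solOp Ω Γ A) (solOp Ω Γ (A + B)) ∧
        HasSum (fun k : ℕ =>
          ((k.factorial : ℂ)⁻¹) • iteratedFDeriv ℂ k (ndMap Ω Γ) A (fun _ => B))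
          (ndMap Ω Γ (A + B)) ∧
        ndMap Ω Γ (A + B) =
          traceMean Ω Γ ∘L (∑' k : ℕ, (perturbOp Ω Γ A B ^ k) ∘L solOp Ω Γ A)) :=
  mainTheorem1_general hΩ (hΓ.elim fun _ h => h.2 ▸ Set.inter_subset_right)
    (surfaceMeasure_ne_zero hΩ hΓ hΓne)
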